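/- Let $k\ge 1$ and $d$ be integers. Let $\mathrm{POVM}_{d,k}$ be the set of $k$-outcome POVMs on $\mathbb C^d$, i.e. of $k$-tuples $(m_1,\dots,m_k)$ of positive semidefinite complex $d\times d$ matrices with $\sum_i m_i=I_d$. It lies in the real affine space $A_{d,k}$ of $k$-tuples of Hermitian $d\times d$ matrices with sum $I_d$; let $\mathrm{Leb}$ be a Lebesgue (i.e. translation-invariant, with any normalization) measure on $A_{d,k}$. A Wishart-random POVM of parameters $(d,k;s_1,\dots,s_k)$ is the $k$-tuple $M_i=S^{-1/2}W_iS^{-1/2}$, where $S=\sum_j W_j$, $W_i=G_i^*G_i$, and $G_1,\dots,G_k$ are independent, $G_i$ being an $s_i\times d$ matrix with i.i.d. standard complex Gaussian entries. A Haar-random POVM of parameters $(d,k;n)$, $d\le kn$, is the $k$-tuple $M_i=V^*(|e_i\rangle\langle e_i|\otimes I_n)V$, where $(e_i)_{i=1}^k$ is a fixed orthonormal basis of $\mathbb C^k$ and $V:\mathbb C^d\to\mathbb C^k\otimes\mathbb C^n$ is a Haar-distributed random isometry (the first $d$ columns of a Haar-distributed unitary matrix of size $kn$). Then $0<\mathrm{Leb}(\mathrm{POVM}_{d,k})<\infty$,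 and: 1. the distribution of a Wishart-random POVM of parameters $(d,k;d,\dots,d)$ has a flat density with respect to $\mathrm{Leb}$: for some constant $0<C<\infty$ this density is $C\,\mathbf 1_{\mathrm{POVM}_{d,k}}$; 2. hence this distribution is the normalized Lebesgue (uniform) probability measure $\mathrm{Leb}(\,\cdot\,\cap \mathrm{POVM}_{d,k})/\mathrm{Leb}(\mathrm{POVM}_{d,k})$ on the set of $k$-outcome POVMs; 3. the distribution of a Haar-random POVM of parameters $(d,k;d)$ (for any choice of the orthonormal basis $(e_i)$) is this same uniform measure. -/

import Mathlib

open MeasureTheory ProbabilityTheory Matrix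
open scoped ComplexOrder Kronecker ENNReal

noncomputable section

namespace RandomPOVM

/-- Matrices carry the product (equivalently, Borel) σ-algebra of their entries. -/
instance instMeasurableSpaceMatrix {m n : Type*} : MeasurableSpace (Matrix m n ℂ) :=
  inferInstanceAs (MeasurableSpace (m → n → ℂ))

instance instBorelSpaceMatrix {m n : Type*} [Finite m] [Finite n] :
    BorelSpace (Matrix m n ℂ) :=
  inferInstanceAs (BorelSpace (m → n → ℂ))

instance instSecondCountableTopologyMatrix {m n : Type*} [Finite m] [Finite n] :
    SecondCountableTopology (Matrix m n ℂ) :=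
  inferInstanceAs (SecondCountableTopology (m → n → ℂ))

instance instLocallyCompactSpaceMatrix {m n : Type*} [Finite m] [Finite n] :
    LocallyCompactSpace (Matrix m n ℂ) :=
  inferInstanceAs (LocallyCompactSpace (m → n → ℂ))

instance instCompactSpaceUnitaryGroup {ι : Type*} [Fintype ι] [DecidableEq ι] :
    CompactSpace (Matrix.unitaryGroup ι ℂ) := by
  have hK : IsCompact (Set.pi Set.univ fun _ : ι => Set.pi Set.univ fun _ : ι =>
      Metric.closedBall (0 : ℂ) 1) :=
    isCompact_univ_pi fun _ => isCompact_univ_pi fun _ => isCompact_closedBall _ _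
  have hclosed : IsClosed {U : Matrix ι ι ℂ | star U * U = 1 ∧ U * star U = 1} :=
    (isClosed_eq (by fun_prop) continuous_const).inter
      (isClosed_eq (by fun_prop) continuous_const)
  refine isCompact_iff_compactSpace.mp (hK.of_isClosed_subset hclosed fun U hU => ?_)
  intro i _ j _
  simpa using entry_norm_bound_of_unitary (𝕜 := ℂ) (U := U) hU i j

/-- The set of `k`-outcome POVMs on `ℂ^d`: `k`-tuples of positive semidefinite `d × d` matrices
summing to the identity. -/
def povmSet (d k : ℕ) : Set (Fin k → Matrix (Fin d) (Fin d) ℂ) :=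
  {m | (∀ i, (m i).PosSemidef) ∧ ∑ i, m i = 1}

/-! ### Lebesgue measure on the set of POVMs -/

/-- The real vector space of `k`-tuples of Hermitian `d × d` matrices with zero sum. It is the
direction of the affine space of `k`-tuples of Hermitian matrices with sum `1`, in which the
set of POVMs is a convex body. -/
def zeroSumHermitian (d k : ℕ) : Submodule ℝ (Fin k → Matrix (Fin d) (Fin d) ℂ) where
  carrier := {x | (∀ i, (x i).IsHermitian) ∧ ∑ i, x i = 0}
  add_mem' := by
    rintro x y ⟨hx, hx'⟩ ⟨hy, hy'⟩
    exact ⟨fun i => (hx i).add (hy i), by simp [Finset.sum_add_distrib, hx', hy']⟩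
  zero_mem' := ⟨fun _ => Matrix.isHermitian_zero, by simp⟩
  smul_mem' := by
    rintro c x ⟨hx, hx'⟩
    refine ⟨fun i => ?_, by simp [← Finset.smul_sum, hx']⟩
    change (c • x i)ᴴ = c • x i
    rw [Matrix.conjTranspose_smul, (hx i).eq, star_trivial]

/-- Lebesgue measure on the affine space of `k`-tuples of Hermitian `d × d` matrices with sum `1`
(seen as a measure on all `k`-tuples of matrices): the translate, by the point `(1/k, …, 1/k)` of
that space, of a Lebesgue (i.e. translation invariant) measure `vol` on its direction. -/
def affineLebesgue {d k : ℕ} (vol : Measure (zeroSumHermitian d k)) :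
    Measure (Fin k → Matrix (Fin d) (Fin d) ℂ) :=
  vol.map fun (x : zeroSumHermitian d k) (i : Fin k) => (x : Fin k → Matrix (Fin d) (Fin d) ℂ) i + ((k : ℂ)⁻¹) • 1

/-- The normalized Lebesgue measure on the set of POVMs. -/
def uniformPOVM {d k : ℕ} (vol : Measure (zeroSumHermitian d k)) :
    Measure (Fin k → Matrix (Fin d) (Fin d) ℂ) :=
  ProbabilityTheory.cond (affineLebesgue vol) (povmSet d k)

/-! ### Wishart-random POVMs -/

/-- The standard complex Gaussian distribution: independent real and imaginary parts, each
centred of variance `1/2`. -/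
def complexGaussian : Measure ℂ :=
  ((gaussianReal 0 (1 / 2)).prod (gaussianReal 0 (1 / 2))).map fun p => (⟨p.1, p.2⟩ : ℂ)

/-- The distribution of an `s × d` Ginibre matrix (i.i.d. standard complex Gaussian entries). -/
def ginibre (s d : ℕ) : Measure (Matrix (Fin s) (Fin d) ℂ) :=
  (Measure.pi fun _ : Fin s => Measure.pi fun _ : Fin d => complexGaussian).map Matrix.of

/-- The Wishart distribution of parameters `(d, s)`: the law of `Gᴴ G`, where `G` is an `s × d`
Ginibre matrix. -/
def wishart (d s : ℕ) : Measure (Matrix (Fin d) (Fin d) ℂ) :=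
  (ginibre s d).map fun G => Gᴴ * G

/-- `S ^ (-1/2)` for a positive semidefinite matrix `S`, by functional calculus (the zero
eigenvalues being sent to zero, so that this is a pseudo-inverse when `S` is singular). -/
def invSqrt {d : ℕ} (S : Matrix (Fin d) (Fin d) ℂ) : Matrix (Fin d) (Fin d) ℂ :=
  cfc (fun x : ℝ => (√x)⁻¹) S

/-- The normalization `(W₁, …, W_k) ↦ (S^(-1/2) W₁ S^(-1/2), …, S^(-1/2) W_k S^(-1/2))` with
`S = W₁ + ⋯ + W_k`. -/
def normalizeTuple {d k : ℕ} (W : Fin k → Matrix (Fin d) (Fin d) ℂ) :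
    Fin k → Matrix (Fin d) (Fin d) ℂ :=
  fun i => invSqrt (∑ j, W j) * W i * invSqrt (∑ j, W j)

/-- The distribution of a Wishart-random POVM of parameters `(d, k; s₁, …, s_k)`: normalize
independent Wishart matrices of parameters `(d, s₁), …, (d, s_k)`. -/
def wishartPOVM (d k : ℕ) (s : Fin k → ℕ) : Measure (Fin k → Matrix (Fin d) (Fin d) ℂ) :=
  (Measure.pi fun i : Fin k => wishart d (s i)).map normalizeTuple

/-! ### Haar-random POVMs -/

/-- The Haar probability measure on the unitary group. -/
def haarUnitary (ι : Type*) [Fintype ι] [DecidableEq ι] : Measure (Matrix.unitaryGroup ι ℂ) :=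
  Measure.haarMeasure ⊤

/-- The distribution of a Haar-random isometry `ℂ^d → ℂ^k ⊗ ℂ^n`: the first `d` columns of a
Haar-distributed unitary matrix of `ℂ^k ⊗ ℂ^n`. -/
def haarIsometry (d k n : ℕ) (h : d ≤ k * n) : Measure (Matrix (Fin k × Fin n) (Fin d) ℂ) :=
  (haarUnitary (Fin k × Fin n)).map fun (U : Matrix.unitaryGroup (Fin k × Fin n) ℂ) =>
    (U : Matrix (Fin k × Fin n) (Fin k × Fin n) ℂ).submatrix id
      fun j => finProdFinEquiv.symm (Fin.castLE h j)

/-- The map `X ↦ V* (X ⊗ I_n) V` from `k × k` to `d × d` matrices, which is unital and completely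
positive when `V` is an isometry. -/
def stinespring {d k n : ℕ} (V : Matrix (Fin k × Fin n) (Fin d) ℂ)
    (X : Matrix (Fin k) (Fin k) ℂ) : Matrix (Fin d) (Fin d) ℂ :=
  Vᴴ * (X ⊗ₖ (1 : Matrix (Fin n) (Fin n) ℂ)) * V

/-- The rank one matrix `|v⟩⟨v|`. -/
def ketBra {k : ℕ} (v : EuclideanSpace ℂ (Fin k)) : Matrix (Fin k) (Fin k) ℂ :=
  Matrix.of fun a b => v a * star (v b)

/-- The distribution of a Haar-random POVM of parameters `(d, k; n)`, constructed from the
orthonormal basis `e` of `ℂ^k`: the images of the projections `|e_i⟩⟨e_i|` under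
`X ↦ V* (X ⊗ I_n) V`, where `V` is a Haar-random isometry. -/
def haarPOVM (d k n : ℕ) (h : d ≤ k * n)
    (e : OrthonormalBasis (Fin k) ℂ (EuclideanSpace ℂ (Fin k))) :
    Measure (Fin k → Matrix (Fin d) (Fin d) ℂ) :=
  (haarIsometry d k n h).map fun V i => stinespring V (ketBra (e i))

end RandomPOVM

end

/-!
The argument rests on two changes of variables, in which no Jacobian has to be computed explicitly.

*Square Wishart matrices.* The maps `G ↦ G A` on all `d × d` matrices and `W ↦ Aᴴ W A` on Hermitian
ones have the same Jacobian: the real determinant of `X ↦ Aᴴ X A` on all matrices is the square of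
either of them, because all matrices are `X + i Y` with `X`, `Y` Hermitian, and because `X ↦ Aᴴ X`
is conjugate to `X ↦ X A` (`abs_det_congrMap`). Hence the image of Lebesgue measure under
`G ↦ Gᴴ G` and Lebesgue measure on the cone of positive definite matrices are relatively invariant,
with the same multiplier, under the transitive action of the general linear group on this cone, and
so they are proportional (`exists_lintegral_conjTranspose_mul_self`). A Ginibre matrix has density
proportional to `exp (-tr Gᴴ G)`, so a square Wishart matrix has density proportional to
`exp (-tr W)` on the positive semidefinite cone (`wishart_self_eq_map_withDensity`).

*Normalization.* The joint density of the `Wᵢ` is thus a function of `S = ∑ Wᵢ` on the set where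
all `Wᵢ` are positive semidefinite. In the linear coordinates `S` and `xᵢ = Wᵢ - S / k`, and for
fixed `S`, the normalized tuple is `S^(-1/2) xᵢ S^(-1/2) + 1 / k`: a linear substitution on tuples
with sum zero, which respects positivity. Its image of Lebesgue measure is proportional to Lebesgue
measure, whatever `S`, and so is the law of the normalized tuple on the set of POVMs
(`exists_wishartPOVM_apply`). The constant follows from the total mass, which also shows that
the set of POVMs has positive measure; it has finite measure because it is compact.

*Haar-random POVMs.* Stack the `k` Ginibre matrices into `G`. The law of `G` is invariant under
multiplication by unitary matrices on the left, so that `V = G (Gᴴ G)^(-1/2)` is a Haar-random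
isometry, by uniqueness of the invariant law (`eq_haarIsometry`). Its blocks satisfy
`Vᵢᴴ Vᵢ = S^(-1/2) Wᵢ S^(-1/2)`, so the Wishart-random and the Haar-random POVM have the same law.
Any orthonormal basis can replace the standard one, again by invariance.
-/

noncomputable section

namespace RandomPOVM

/-! ### Measure-theoretic preliminaries -/

section

theorem lintegral_pi_prod {n : ℕ} {E : Type*} [MeasurableSpace E] (μ : Measure E) [SigmaFinite μ]
    (f : Fin n → E → ℝ≥0∞) (hf : ∀ i, Measurable (f i)) :
    ∫⁻ x, ∏ i, f i (x i) ∂(Measure.pi fun _ : Fin n => μ) = ∏ i, ∫⁻ x, f i x ∂μ := by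
  induction n with
  | zero => simp
  | succ n ih =>
    have hmp := (measurePreserving_piFinSuccAbove (fun _ : Fin (n + 1) => μ) 0).symm
    rw [← hmp.lintegral_comp_emb (MeasurableEquiv.measurableEmbedding _), Fin.prod_univ_succ,
      ← ih (fun i => f i.succ) fun i => hf _, ← lintegral_prod_mul (hf 0).aemeasurable]
    · simp [MeasurableEquiv.piFinSuccAbove, Fin.prod_univ_succ]
    · exact (Finset.measurable_prod _ fun i _ =>
        (hf _).comp (measurable_pi_apply i)).aemeasurable

theorem pi_withDensity {n : ℕ} {E : Type*} [MeasurableSpace E] (μ : Measure E) [SigmaFinite μ]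
    {g : E → ℝ≥0∞} (hg : Measurable g) (hg' : ∀ x, g x ≠ ∞) :
    (Measure.pi fun _ : Fin n => μ.withDensity g) =
      (Measure.pi fun _ : Fin n => μ).withDensity fun x => ∏ i, g (x i) := by
  have : SigmaFinite (μ.withDensity g) := SigmaFinite.withDensity_of_ne_top (.of_forall hg')
  refine Measure.pi_eq fun s hs => ?_
  have hms : MeasurableSet (Set.univ.pi s) := .univ_pi hs
  rw [withDensity_apply _ hms, ← lintegral_indicator hms]
  have : ∀ x : Fin n → E, (Set.univ.pi s).indicator (fun x => ∏ i, g (x i)) x =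
      ∏ i, (s i).indicator g (x i) := fun x => by
    by_cases hx : x ∈ Set.univ.pi s
    · rw [Set.indicator_of_mem hx]
      exact Finset.prod_congr rfl fun i _ => (Set.indicator_of_mem (hx i trivial) _).symm
    · rw [Set.indicator_of_notMem hx]
      simp only [Set.mem_pi, Set.mem_univ, true_implies, not_forall] at hx
      obtain ⟨i, hi⟩ := hx
      exact (Finset.prod_eq_zero (Finset.mem_univ i) (Set.indicator_of_notMem hi _)).symm
  simp_rw [this]
  rw [lintegral_pi_prod μ _ fun i => hg.indicator (hs i)]
  exact Finset.prod_congr rfl fun i _ => by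
    rw [lintegral_indicator (hs i), withDensity_apply _ (hs i)]

section Linear

variable {E : Type*} [AddCommGroup E] [Module ℝ E] [TopologicalSpace E] [IsTopologicalAddGroup E]
  [ContinuousSMul ℝ E] [T2Space E] [MeasurableSpace E] [BorelSpace E] [FiniteDimensional ℝ E]
  (μ : Measure E) [μ.IsAddHaarMeasure]

/-- Linear change of variables, for an arbitrary integrand, in a space without a preferred norm. -/
theorem lintegral_comp_linearMap {L : E →ₗ[ℝ] E} (hL : LinearMap.det L ≠ 0) (f : E → ℝ≥0∞) :
    ∫⁻ x, f (L x) ∂μ = ENNReal.ofReal |(LinearMap.det L)⁻¹| * ∫⁻ x, f x ∂μ := by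
  let e : E ≃L[ℝ] (Fin (Module.finrank ℝ E) → ℝ) := ContinuousLinearEquiv.ofFinrankEq (by simp)
  have hem : MeasurableEmbedding e := e.toHomeomorph.measurableEmbedding
  let L' := e.toLinearEquiv.toLinearMap ∘ₗ L ∘ₗ e.toLinearEquiv.symm.toLinearMap
  have hdet : LinearMap.det L' = LinearMap.det L := LinearMap.det_conj L e.toLinearEquiv
  have he : MeasurableEmbedding L' :=
    (L'.equivOfDetNeZero (hdet ▸ hL)).toContinuousLinearEquiv.toHomeomorph.measurableEmbedding
  have h1 : ∀ g : (Fin (Module.finrank ℝ E) → ℝ) → ℝ≥0∞, ∫⁻ y, g y ∂(μ.map e) =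
      ∫⁻ x, g (e x) ∂μ := fun g => hem.lintegral_map g
  have h2 : ∫⁻ y, f (e.symm (L' y)) ∂(μ.map e) =
      ENNReal.ofReal |(LinearMap.det L)⁻¹| * ∫⁻ y, f (e.symm y) ∂(μ.map e) := by
    rw [← he.lintegral_map (fun y => f (e.symm y)),
      Measure.map_linearMap_addHaar_eq_smul_addHaar (μ.map e) (hdet ▸ hL),
      lintegral_smul_measure, smul_eq_mul, hdet]
  rw [h1, h1] at h2
  simpa [L'] using h2

/-- A linear space of matrices that contains the identity meets the singular matrices in a null
set: each line in the direction of the identity contains finitely many of them. -/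
theorem ae_det_ne_zero {d : ℕ} (φ : E →ₗ[ℝ] Matrix (Fin d) (Fin d) ℂ)
    {e : E} (he : φ e = 1) : ∀ᵐ x ∂μ, (φ x).det ≠ 0 := by
  let u : E ≃L[ℝ] (Fin (Module.finrank ℝ E) → ℝ) := ContinuousLinearEquiv.ofFinrankEq (by simp)
  have hφ : Measurable fun y => (φ (u.symm y)).det := by
    have : Continuous φ := φ.continuous_of_finiteDimensional
    exact (Continuous.matrix_det (this.comp u.symm.continuous)).measurable
  have hm : MeasurableSet {y | (φ (u.symm y)).det ≠ 0} := hφ (measurableSet_singleton 0).compl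
  have h1 : ∀ y, ∀ᵐ t : ℝ, (φ (u.symm (y + t • u e))).det ≠ 0 := by
    intro y
    have hfin : {t : ℝ | (φ (u.symm (y + t • u e))).det = 0}.Finite := by
      have : {t : ℝ | (φ (u.symm (y + t • u e))).det = 0} ⊆
          (fun t : ℝ => (t : ℂ)) ⁻¹' {z | (-(φ (u.symm y))).charpoly.IsRoot z} := fun t ht => by
        simp only [Set.mem_ofPred_eq, map_add, map_smul, he,
          ContinuousLinearEquiv.symm_apply_apply] at ht
        simp only [Set.mem_preimage, Set.mem_ofPred_eq, Polynomial.IsRoot, Matrix.eval_charpoly]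
        rw [← ht]
        congr 1
        ext i j
        simp [Matrix.scalar_apply, Matrix.diagonal_apply, Matrix.one_apply, add_comm]
      refine Set.Finite.subset (Set.Finite.preimage Complex.ofReal_injective.injOn ?_) this
      exact Polynomial.finite_setOfPred_isRoot (Matrix.charpoly_monic _).ne_zero
    filter_upwards [measure_eq_zero_iff_ae_notMem.mp (hfin.measure_zero volume)] with t ht using ht
  have h2 : ∀ᵐ y ∂(μ.map u), (φ (u.symm y)).det ≠ 0 :=
    ae_mem_of_ae_add_linearMap_mem (LinearMap.toSpanSingleton ℝ _ (u e)) volume (μ.map u) hm h1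
  have h3 := ae_of_ae_map u.continuous.aemeasurable h2
  simpa using h3

end Linear

end

/-! ### The inverse square root of a matrix -/

section

/-- The function `x ↦ (√x)⁻¹` is a pointwise limit of polynomials: it is a pointwise limit of
continuous functions, and each of these is approximated by a polynomial on a large interval. -/
theorem exists_polynomial_tendsto_inv_sqrt :
    ∃ p : ℕ → Polynomial ℝ, ∀ x : ℝ,
      Filter.Tendsto (fun n => (p n).eval x) Filter.atTop (nhds (√x)⁻¹) := by
  have hg : ∀ n : ℕ, Continuous fun x : ℝ => √x / (√x ^ 2 + 1 / (n + 1 : ℝ)) := fun n => by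
    refine Continuous.div (by fun_prop) (by fun_prop) fun x => ?_
    positivity
  have happ : ∀ n : ℕ, ∃ p : Polynomial ℝ, ∀ x ∈ Set.Icc (-(n : ℝ)) n,
      |p.eval x - √x / (√x ^ 2 + 1 / (n + 1 : ℝ))| < 1 / (n + 1 : ℝ) := fun n =>
    exists_polynomial_near_of_continuousOn _ _ _ (hg n).continuousOn _ (by positivity)
  choose p hp using happ
  refine ⟨p, fun x => ?_⟩
  have h0 : Filter.Tendsto (fun n : ℕ => 1 / (n + 1 : ℝ)) Filter.atTop (nhds 0) :=
    tendsto_one_div_add_atTop_nhds_zero_nat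
  have h1 : Filter.Tendsto (fun n : ℕ => √x / (√x ^ 2 + 1 / (n + 1 : ℝ))) Filter.atTop
      (nhds (√x)⁻¹) := by
    by_cases hx : √x = 0
    · simp [hx]
    · have : (√x)⁻¹ = √x / (√x ^ 2 + 0) := by field_simp; simp
      rw [this]
      exact tendsto_const_nhds.div (tendsto_const_nhds.add h0) (by simpa using hx)
  have h2 : Filter.Tendsto (fun n => (p n).eval x - √x / (√x ^ 2 + 1 / (n + 1 : ℝ)))
      Filter.atTop (nhds 0) := by
    refine squeeze_zero_norm' ?_ h0
    obtain ⟨N, hN⟩ := exists_nat_ge |x|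
    filter_upwards [Filter.eventually_ge_atTop N] with n hn
    have : |x| ≤ n := hN.trans (by exact_mod_cast hn)
    exact (hp n x (abs_le.mp this)).le
  simpa using h2.add h1

variable {d : ℕ}

theorem measurableSet_isHermitian :
    MeasurableSet {S : Matrix (Fin d) (Fin d) ℂ | S.IsHermitian} :=
  (isClosed_eq (by fun_prop) (by fun_prop)).measurableSet

theorem measurable_invSqrt :
    Measurable (invSqrt : Matrix (Fin d) (Fin d) ℂ → Matrix (Fin d) (Fin d) ℂ) := by
  classical
  obtain ⟨p, hp⟩ := exists_polynomial_tendsto_inv_sqrt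
  have hlim : ∀ S : Matrix (Fin d) (Fin d) ℂ, Filter.Tendsto
      (fun n => if S.IsHermitian then Polynomial.aeval S (p n) else 0) Filter.atTop
      (nhds (invSqrt S)) := fun S => by
    by_cases hS : S.IsHermitian
    · have hS' : IsSelfAdjoint S := hS
      have hfin : (spectrum ℝ S).Finite := Matrix.finite_real_spectrum
      simp only [if_pos hS]
      have : ∀ n, Polynomial.aeval S (p n) = cfc (fun x : ℝ => (p n).eval x) S := fun n =>
        (cfc_polynomial (p n) S hS').symm
      simp_rw [this]
      refine tendsto_cfc_fun ?_ (.of_forall fun n => (p n).continuousOn)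
      have := hfin.isCompact
      rw [Metric.tendstoUniformlyOn_iff]
      intro ε hε
      rw [Filter.eventually_all_finite hfin] 
      intro x _
      have := Metric.tendsto_nhds.mp (hp x) ε hε
      simpa [dist_comm] using this
    · have hS' : ¬ IsSelfAdjoint S := hS
      simp only [if_neg hS, invSqrt, cfc_apply_of_not_predicate S hS']
      exact tendsto_const_nhds
  refine measurable_of_tendsto_metrizable (fun n => ?_) (tendsto_pi_nhds.mpr hlim)
  refine Measurable.ite measurableSet_isHermitian ?_ measurable_const
  have : Continuous fun S : Matrix (Fin d) (Fin d) ℂ => Polynomial.aeval S (p n) := by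
    fun_prop
  exact this.measurable

theorem invSqrt_isHermitian (S : Matrix (Fin d) (Fin d) ℂ) : (invSqrt S).IsHermitian :=
  cfc_predicate (fun x : ℝ => (√x)⁻¹) S

theorem _root_.Matrix.PosDef.invSqrt_mul_self {S : Matrix (Fin d) (Fin d) ℂ} (hS : S.PosDef) :
    invSqrt S * S * invSqrt S = 1 := by
  have hS' : IsSelfAdjoint S := hS.isHermitian
  have hfin : (spectrum ℝ S).Finite := Matrix.finite_real_spectrum
  have hc : ∀ f : ℝ → ℝ, ContinuousOn f (spectrum ℝ S) := fun f => hfin.continuousOn f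
  nth_rw 2 [← cfc_id ℝ S]
  rw [invSqrt, ← cfc_mul _ _ S (hc _) (hc _), ← cfc_mul _ _ S (hc _) (hc _), ← cfc_one ℝ S]
  refine cfc_congr fun x hx => ?_
  have hx0 : 0 < x := by
    rw [hS.isHermitian.spectrum_real_eq_range_eigenvalues] at hx
    obtain ⟨i, rfl⟩ := hx
    exact hS.eigenvalues_pos i
  have := Real.sqrt_pos.mpr hx0
  simp only [id, Pi.one_apply]
  field_simp
  exact (Real.sq_sqrt hx0.le).symm

theorem _root_.Matrix.PosDef.isUnit_det_invSqrt {S : Matrix (Fin d) (Fin d) ℂ} (hS : S.PosDef) :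
    IsUnit (invSqrt S).det := by
  have := congrArg Matrix.det hS.invSqrt_mul_self
  rw [det_mul, det_mul, det_one, mul_assoc] at this
  exact IsUnit.of_mul_eq_one _ this

theorem _root_.Matrix.PosDef.exists_isHermitian_mul_self {w : Matrix (Fin d) (Fin d) ℂ}
    (hw : w.PosDef) : ∃ B : Matrix (Fin d) (Fin d) ℂ, B.IsHermitian ∧ IsUnit B.det ∧ B * B = w := by
  have hu := hw.isUnit_det_invSqrt
  refine ⟨(invSqrt w)⁻¹, (invSqrt_isHermitian w).inv, Matrix.isUnit_nonsing_inv_det _ hu, ?_⟩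
  calc (invSqrt w)⁻¹ * (invSqrt w)⁻¹
      = (invSqrt w)⁻¹ * (invSqrt w * w * invSqrt w) * (invSqrt w)⁻¹ := by
        rw [hw.invSqrt_mul_self, mul_one]
    _ = w := by
        rw [mul_assoc (invSqrt w), Matrix.nonsing_inv_mul_cancel_left _ _ hu,
          Matrix.mul_nonsing_inv_cancel_right _ _ hu]

theorem _root_.Matrix.IsHermitian.exists_posDef_add_natCast {w : Matrix (Fin d) (Fin d) ℂ}
    (hw : w.IsHermitian) : ∃ n : ℕ, (w + n • (1 : Matrix (Fin d) (Fin d) ℂ)).PosDef := by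
  obtain ⟨b, hb⟩ := (Matrix.finite_real_spectrum (A := w)).bddBelow
  obtain ⟨n, hn⟩ := exists_nat_ge (-b)
  refine ⟨n + 1, ?_⟩
  rw [add_smul, one_smul, ← add_assoc]
  refine PosDef.posSemidef_add ?_ PosDef.one
  have hh : (w + n • (1 : Matrix (Fin d) (Fin d) ℂ)).IsHermitian := hw.add (by simp [IsHermitian])
  refine hh.posSemidef_iff_eigenvalues_nonneg.mpr fun i => ?_
  have hx : hh.eigenvalues i ∈ spectrum ℝ (w + algebraMap ℝ _ (n : ℝ)) := by
    rw [Algebra.algebraMap_eq_smul_one, Nat.cast_smul_eq_nsmul]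
    exact hh.eigenvalues_mem_spectrum_real i
  rw [← spectrum.add_singleton_eq] at hx
  obtain ⟨y, hy, z, rfl, hyz⟩ := hx
  have := hb hy
  simp only [Pi.zero_apply] at hyz ⊢
  linarith

open scoped MatrixOrder in
theorem _root_.Matrix.PosSemidef.exists_eq_conjTranspose_mul_self
    {w : Matrix (Fin d) (Fin d) ℂ} (hw : w.PosSemidef) :
    ∃ B : Matrix (Fin d) (Fin d) ℂ, w = Bᴴ * B :=
  CStarAlgebra.nonneg_iff_eq_star_mul_self.mp hw.nonneg

/-- The entries of a positive semidefinite matrix are controlled by its diagonal. -/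
theorem _root_.Matrix.PosSemidef.norm_apply_le {w : Matrix (Fin d) (Fin d) ℂ}
    (hw : w.PosSemidef) (i j : Fin d) : ‖w i j‖ ≤ (‖w i i‖ + ‖w j j‖) / 2 := by
  obtain ⟨B, rfl⟩ := hw.exists_eq_conjTranspose_mul_self
  have hdiag : ∀ l, ‖(Bᴴ * B) l l‖ = ∑ a, ‖B a l‖ ^ 2 := fun l => by
    have : (Bᴴ * B) l l = ((∑ a, ‖B a l‖ ^ 2 : ℝ) : ℂ) := by
      simp [mul_apply, conjTranspose_apply, Complex.conj_mul']
    rw [this, Complex.norm_real, Real.norm_of_nonneg (by positivity)]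
  rw [hdiag, hdiag, mul_apply, ← Finset.sum_add_distrib, Finset.sum_div]
  refine (norm_sum_le _ _).trans (Finset.sum_le_sum fun a _ => ?_)
  rw [norm_mul, conjTranspose_apply, norm_star]
  nlinarith [sq_nonneg (‖B a i‖ - ‖B a j‖)]

/-! ### Determinants of multiplication operators -/

/-- The real vector space of Hermitian `d × d` matrices. -/
abbrev hermitian (d : ℕ) : Submodule ℝ (Matrix (Fin d) (Fin d) ℂ) :=
  selfAdjoint.submodule ℝ (Matrix (Fin d) (Fin d) ℂ)

theorem mem_hermitian {X : Matrix (Fin d) (Fin d) ℂ} : X ∈ hermitian d ↔ X.IsHermitian := Iff.rfl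

/-- The real-linear action `X ↦ Aᴴ X A` on Hermitian matrices. -/
def congrMap (A : Matrix (Fin d) (Fin d) ℂ) : hermitian d →ₗ[ℝ] hermitian d :=
  (LinearMap.mulLeft ℝ Aᴴ ∘ₗ LinearMap.mulRight ℝ A).restrict fun X hX => by
    have : (Aᴴ * X * A).IsHermitian := isHermitian_conjTranspose_mul_mul A hX
    simpa [mem_hermitian, mul_assoc] using this

theorem coe_congrMap (A : Matrix (Fin d) (Fin d) ℂ) (X : hermitian d) :
    (congrMap A X : Matrix (Fin d) (Fin d) ℂ) = Aᴴ * X * A := by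
  simp [congrMap, mul_assoc]

theorem det_mulLeft_conjTranspose (A : Matrix (Fin d) (Fin d) ℂ) :
    LinearMap.det (LinearMap.mulLeft ℝ Aᴴ) = LinearMap.det (LinearMap.mulRight ℝ A) := by
  rw [← LinearMap.det_conj _ (conjTransposeLinearEquiv (Fin d) (Fin d) ℝ ℂ)]
  congr 1
  ext1 X
  simp [conjTransposeLinearEquiv]

open ComplexStarModule in
/-- A matrix is uniquely `X + i Y` with `X`, `Y` Hermitian. -/
def hermitianProdEquiv (d : ℕ) :
    (hermitian d × hermitian d) ≃ₗ[ℝ] Matrix (Fin d) (Fin d) ℂ where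
  toFun p := p.1 + Complex.I • (p.2 : Matrix (Fin d) (Fin d) ℂ)
  map_add' p q := by simp; abel
  map_smul' c p := by simp [smul_comm c Complex.I]
  invFun Z := (⟨ℜ Z, (ℜ Z).2⟩, ⟨ℑ Z, (ℑ Z).2⟩)
  left_inv p := by
    have h1 : IsSelfAdjoint (p.1 : Matrix (Fin d) (Fin d) ℂ) := p.1.2
    have h2 : IsSelfAdjoint (p.2 : Matrix (Fin d) (Fin d) ℂ) := p.2.2
    ext1 <;> ext1 <;> simp [h1.coe_realPart, h2.coe_realPart, h1.imaginaryPart,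
      h2.imaginaryPart, realPart_I_smul, imaginaryPart_I_smul]
  right_inv Z := realPart_add_I_smul_imaginaryPart Z

theorem hermitianProdEquiv_apply (p : hermitian d × hermitian d) :
    hermitianProdEquiv d p = p.1 + Complex.I • (p.2 : Matrix (Fin d) (Fin d) ℂ) := rfl

/-- The two natural actions of an invertible matrix `A`, `W ↦ Aᴴ W A` on Hermitian matrices and
`G ↦ G A` on all matrices, scale Lebesgue measure in the same way. Both sides are computed from the
determinant of `X ↦ Aᴴ X A` on all matrices. -/
theorem abs_det_congrMap (A : Matrix (Fin d) (Fin d) ℂ) :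
    |LinearMap.det (congrMap A)| = |LinearMap.det (LinearMap.mulRight ℝ A)| := by
  have h1 : LinearMap.det (LinearMap.mulLeft ℝ Aᴴ ∘ₗ LinearMap.mulRight ℝ A) =
      LinearMap.det (congrMap A) * LinearMap.det (congrMap A) := by
    rw [← LinearMap.det_prodMap, ← LinearMap.det_conj _ (hermitianProdEquiv d)]
    congr 1
    refine LinearMap.ext fun Z => ?_
    obtain ⟨p, rfl⟩ := (hermitianProdEquiv d).surjective Z
    simp only [LinearEquiv.coe_coe, LinearMap.comp_apply, LinearEquiv.symm_apply_apply]
    simp [hermitianProdEquiv_apply, coe_congrMap, mul_add, add_mul, mul_assoc]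
  rw [LinearMap.det_comp, det_mulLeft_conjTranspose] at h1
  exact (sq_eq_sq_iff_abs_eq_abs _ _).mp (by rw [sq, sq, h1])

end

/-! ### Square Wishart matrices -/

section

variable {d : ℕ}

instance instLocallyCompactSpaceHermitian : LocallyCompactSpace (hermitian d) :=
  have : IsClosed (hermitian d : Set (Matrix (Fin d) (Fin d) ℂ)) :=
    isClosed_eq (by fun_prop) (by fun_prop)
  this.isClosedEmbedding_subtypeVal.locallyCompactSpace

instance instSecondCountableTopologyHermitian : SecondCountableTopology (hermitian d) :=
  TopologicalSpace.Subtype.secondCountableTopology _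

/-- Matrices with bounded entries form a compact set. -/
theorem isCompact_norm_entry_le (r : ℝ) :
    IsCompact {w : Matrix (Fin d) (Fin d) ℂ | ∀ i j, ‖w i j‖ ≤ r} := by
  have : IsCompact (Set.pi Set.univ fun _ : Fin d => Set.pi Set.univ fun _ : Fin d =>
      Metric.closedBall (0 : ℂ) r) :=
    isCompact_univ_pi fun _ => isCompact_univ_pi fun _ => isCompact_closedBall _ _
  have heq : ({w | ∀ i j, ‖w i j‖ ≤ r} : Set (Fin d → Fin d → ℂ)) = Set.pi Set.univ
      fun _ : Fin d => Set.pi Set.univ fun _ : Fin d => Metric.closedBall (0 : ℂ) r := by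
    ext w
    simp
  exact heq ▸ this

theorem isClosed_posSemidef : IsClosed {w : Matrix (Fin d) (Fin d) ℂ | w.PosSemidef} := by
  simp_rw [posSemidef_iff_dotProduct_mulVec, Set.ofPred_and, Set.ofPred_forall]
  refine IsClosed.inter (isClosed_eq (by fun_prop) (by fun_prop)) (isClosed_iInter fun x => ?_)
  exact isClosed_le continuous_const (by fun_prop)

theorem measurableSet_posDef : MeasurableSet {w : Matrix (Fin d) (Fin d) ℂ | w.PosDef} := by
  have : {w : Matrix (Fin d) (Fin d) ℂ | w.PosDef} = {w | w.PosSemidef} ∩ {w | w.det = 0}ᶜ := by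
    ext w
    exact ⟨fun h => ⟨h.posSemidef, h.det_pos.ne'⟩, fun h => h.1.posDef_iff_det_ne_zero.mpr h.2⟩
  rw [this]
  refine isClosed_posSemidef.measurableSet.inter (IsClosed.measurableSet ?_).compl
  exact isClosed_eq (by fun_prop) continuous_const

theorem measurable_matrix_inv :
    Measurable fun A : Matrix (Fin d) (Fin d) ℂ => A⁻¹ := by
  have h1 : Measurable fun A : Matrix (Fin d) (Fin d) ℂ => (A.det)⁻¹ :=
    (Continuous.matrix_det continuous_id).measurable.inv
  have h2 : Measurable fun A : Matrix (Fin d) (Fin d) ℂ => A.adjugate :=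
    (Continuous.matrix_adjugate continuous_id).measurable
  simp_rw [Matrix.inv_def, Ring.inverse_eq_inv']
  exact h1.smul h2

theorem measurable_conjTranspose_mul_mul {α : Type*} [MeasurableSpace α]
    {X w : α → Matrix (Fin d) (Fin d) ℂ} (hX : Measurable X) (hw : Measurable w) :
    Measurable fun a => (X a)ᴴ * w a * X a := by
  have hc : Continuous fun p : Matrix (Fin d) (Fin d) ℂ × Matrix (Fin d) (Fin d) ℂ =>
      p.1ᴴ * p.2 * p.1 := by fun_prop
  have := hc.measurable.comp (hX.prodMk hw)
  exact this

theorem continuous_det_mulLeft :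
    Continuous fun A : Matrix (Fin d) (Fin d) ℂ => LinearMap.det (LinearMap.mulLeft ℝ A) := by
  let b := Module.finBasis ℝ (Matrix (Fin d) (Fin d) ℂ)
  simp_rw [← LinearMap.det_toMatrix b]
  exact Continuous.matrix_det (((LinearMap.toMatrix b b).toLinearMap ∘ₗ
    LinearMap.mul ℝ (Matrix (Fin d) (Fin d) ℂ)).continuous_of_finiteDimensional)

theorem continuous_det_mulRight :
    Continuous fun A : Matrix (Fin d) (Fin d) ℂ => LinearMap.det (LinearMap.mulRight ℝ A) := by
  let b := Module.finBasis ℝ (Matrix (Fin d) (Fin d) ℂ)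
  simp_rw [← LinearMap.det_toMatrix b]
  exact Continuous.matrix_det (((LinearMap.toMatrix b b).toLinearMap ∘ₗ
    (LinearMap.mul ℝ (Matrix (Fin d) (Fin d) ℂ)).flip).continuous_of_finiteDimensional)

theorem det_mulLeft_mul (A B : Matrix (Fin d) (Fin d) ℂ) :
    LinearMap.det (LinearMap.mulLeft ℝ (A * B)) =
      LinearMap.det (LinearMap.mulLeft ℝ A) * LinearMap.det (LinearMap.mulLeft ℝ B) := by
  rw [LinearMap.mulLeft_mul, LinearMap.det_comp]

theorem det_mulRight_mul (A B : Matrix (Fin d) (Fin d) ℂ) :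
    LinearMap.det (LinearMap.mulRight ℝ (A * B)) =
      LinearMap.det (LinearMap.mulRight ℝ A) * LinearMap.det (LinearMap.mulRight ℝ B) := by
  rw [LinearMap.mulRight_mul, LinearMap.det_comp, mul_comm]

theorem det_mulLeft_ne_zero {A : Matrix (Fin d) (Fin d) ℂ} (hA : IsUnit A.det) :
    LinearMap.det (LinearMap.mulLeft ℝ A) ≠ 0 := by
  have := det_mulLeft_mul A A⁻¹
  rw [Matrix.mul_nonsing_inv _ hA, LinearMap.mulLeft_one, LinearMap.det_id] at this
  exact left_ne_zero_of_mul (this ▸ one_ne_zero)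

theorem det_mulRight_ne_zero {A : Matrix (Fin d) (Fin d) ℂ} (hA : IsUnit A.det) :
    LinearMap.det (LinearMap.mulRight ℝ A) ≠ 0 := by
  have := det_mulRight_mul A A⁻¹
  rw [Matrix.mul_nonsing_inv _ hA, LinearMap.mulRight_one, LinearMap.det_id] at this
  exact left_ne_zero_of_mul (this ▸ one_ne_zero)

variable (μ : Measure (Matrix (Fin d) (Fin d) ℂ)) [μ.IsAddHaarMeasure]
  (ν : Measure (hermitian d)) [ν.IsAddHaarMeasure]

/-- There are enough positive definite matrices: their translates by multiples of the identity
cover the space of Hermitian matrices. -/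
theorem measure_posDef_ne_zero :
    ν {w | (w : Matrix (Fin d) (Fin d) ℂ).PosDef} ≠ 0 := by
  intro h0
  let e : hermitian d := ⟨1, mem_hermitian.mpr isHermitian_one⟩
  have hcov : (Set.univ : Set (hermitian d)) ⊆
      ⋃ n : ℕ, (fun w => w + n • e) ⁻¹' {w | (w : Matrix (Fin d) (Fin d) ℂ).PosDef} :=
    fun w _ => by
      obtain ⟨n, hn⟩ := (mem_hermitian.mp w.2).exists_posDef_add_natCast
      exact Set.mem_iUnion.mpr ⟨n, by simpa [e] using hn⟩
  refine (NeZero.ne (ν Set.univ)) (measure_mono_null hcov (measure_iUnion_null fun n => ?_))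
  rw [measure_preimage_add_right]
  exact h0

/-- A set of positive definite matrices that has finite nonzero Lebesgue measure and whose
preimage under `G ↦ Gᴴ G` has finite Lebesgue measure. -/
theorem exists_testSet : ∃ C : Set (Matrix (Fin d) (Fin d) ℂ), MeasurableSet C ∧
    (∀ w ∈ C, w.PosDef) ∧ ν (Subtype.val ⁻¹' C) ≠ 0 ∧ ν (Subtype.val ⁻¹' C) ≠ ∞ ∧
    μ {G | Gᴴ * G ∈ C} ≠ ∞ := by
  let K : ℕ → Set (Matrix (Fin d) (Fin d) ℂ) := fun n => {w | ∀ i j, ‖w i j‖ ≤ n}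
  have hK : ∀ n, IsCompact (K n) := fun n => isCompact_norm_entry_le _
  let C : ℕ → Set (Matrix (Fin d) (Fin d) ℂ) := fun n => {w | w.PosDef} ∩ K n
  have hC : ∃ n, ν (Subtype.val ⁻¹' C n) ≠ 0 := by
    by_contra! h
    refine measure_posDef_ne_zero ν (measure_mono_null ?_ (measure_iUnion_null h))
    intro w hw
    obtain ⟨r, hr⟩ := (Set.finite_range fun p : Fin d × Fin d =>
      ‖(w : Matrix (Fin d) (Fin d) ℂ) p.1 p.2‖).bddAbove
    obtain ⟨n, hn⟩ := exists_nat_ge r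
    exact Set.mem_iUnion.mpr ⟨n, hw, fun i j => (hr ⟨(i, j), rfl⟩).trans hn⟩
  obtain ⟨n, hn⟩ := hC
  refine ⟨C n, measurableSet_posDef.inter (hK n).isClosed.measurableSet,
    fun w hw => hw.1, hn, ?_, ?_⟩
  · have hcl : IsClosed (hermitian d : Set (Matrix (Fin d) (Fin d) ℂ)) :=
      isClosed_eq (by fun_prop) (by fun_prop)
    exact ((measure_mono fun w hw => hw.2).trans_lt
      (hcl.isClosedEmbedding_subtypeVal.isCompact_preimage (hK n)).measure_lt_top).ne
  · refine ((measure_mono ?_).trans_lt (isCompact_norm_entry_le √n).measure_lt_top).ne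
    intro G hG i j
    have h1 : ‖(Gᴴ * G) j j‖ ≤ n := hG.2 j j
    have h2 : (Gᴴ * G) j j = ((∑ a, ‖G a j‖ ^ 2 : ℝ) : ℂ) := by
      simp [mul_apply, conjTranspose_apply, Complex.conj_mul']
    rw [h2, Complex.norm_real, Real.norm_of_nonneg (by positivity)] at h1
    refine Real.le_sqrt_of_sq_le (le_trans ?_ h1)
    exact Finset.single_le_sum (f := fun a => ‖G a j‖ ^ 2) (fun _ _ => by positivity)
      (Finset.mem_univ i)

/-- The substitution `G = B A` with `B = √w`; its Jacobian is the square root of that of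
`A ↦ w A`. -/
theorem lintegral_conj_eq {w B : Matrix (Fin d) (Fin d) ℂ} (hB : B.IsHermitian)
    (hBu : IsUnit B.det) (hw : B * B = w) (f : Matrix (Fin d) (Fin d) ℂ → ℝ≥0∞) :
    ENNReal.ofReal √|LinearMap.det (LinearMap.mulLeft ℝ w)| * ∫⁻ A, f (Aᴴ * w * A) ∂μ =
      ∫⁻ G, f (Gᴴ * G) ∂μ := by
  have hne := det_mulLeft_ne_zero hBu
  have h1 : ∀ A, f (Aᴴ * w * A) =
      (fun G => f (Gᴴ * G)) (LinearMap.mulLeft ℝ B A) := fun A => by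
    simp [← hw, conjTranspose_mul, hB.eq, mul_assoc]
  rw [lintegral_congr h1]
  rw [lintegral_comp_linearMap μ hne (fun G => f (Gᴴ * G)), ← mul_assoc,
    ← ENNReal.ofReal_mul (by positivity), ← hw, det_mulLeft_mul, ← sq, abs_pow,
    Real.sqrt_sq (abs_nonneg _), abs_inv, mul_inv_cancel₀ (abs_ne_zero.mpr hne)]
  simp

/-- The inner integral over `A` is the same for all positive definite `w = B * B`, because the
measure `|det (X ↦ X A)|⁻¹ dA` is invariant under `A ↦ A B`. It vanishes for other `w`. -/
theorem lintegral_conj_inv_eq {h : Matrix (Fin d) (Fin d) ℂ → ℝ≥0∞}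
    (hP : ∀ w, h w ≠ 0 → w.PosDef) (w : Matrix (Fin d) (Fin d) ℂ) :
    ∫⁻ A, ENNReal.ofReal |(LinearMap.det (LinearMap.mulRight ℝ A))⁻¹| * h ((A⁻¹)ᴴ * w * A⁻¹) ∂μ =
      {w | w.PosDef}.indicator (fun _ => ∫⁻ A, ENNReal.ofReal
        |(LinearMap.det (LinearMap.mulRight ℝ A))⁻¹| * h ((A⁻¹)ᴴ * A⁻¹) ∂μ) w := by
  by_cases hw : w.PosDef
  · rw [Set.indicator_of_mem (by exact hw)]
    obtain ⟨B, hB, hBu, rfl⟩ := hw.exists_isHermitian_mul_self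
    have hne' := det_mulRight_ne_zero (Matrix.isUnit_nonsing_inv_det _ hBu)
    set Ψ : Matrix (Fin d) (Fin d) ℂ → ℝ≥0∞ := fun A =>
      ENNReal.ofReal |(LinearMap.det (LinearMap.mulRight ℝ A))⁻¹| * h ((A⁻¹)ᴴ * A⁻¹) with hΨ
    have hsub : ∀ A, ENNReal.ofReal |(LinearMap.det (LinearMap.mulRight ℝ A))⁻¹| *
        h ((A⁻¹)ᴴ * (B * B) * A⁻¹) =
        ENNReal.ofReal |LinearMap.det (LinearMap.mulRight ℝ B⁻¹)| *
          Ψ (LinearMap.mulRight ℝ B⁻¹ A) := fun A => by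
      have h1 : ((A * B⁻¹)⁻¹)ᴴ * (A * B⁻¹)⁻¹ = (A⁻¹)ᴴ * (B * B) * A⁻¹ := by
        rw [Matrix.mul_inv_rev, Matrix.nonsing_inv_nonsing_inv _ hBu, conjTranspose_mul, hB.eq]
        simp only [mul_assoc]
      have h2 : |LinearMap.det (LinearMap.mulRight ℝ B⁻¹)| *
          |(LinearMap.det (LinearMap.mulRight ℝ (A * B⁻¹)))⁻¹| =
          |(LinearMap.det (LinearMap.mulRight ℝ A))⁻¹| := by
        rw [det_mulRight_mul, mul_inv, abs_mul, mul_left_comm, ← abs_mul, mul_inv_cancel₀ hne',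
          abs_one, mul_one]
      simp only [hΨ, LinearMap.mulRight_apply]
      rw [h1, ← h2, ENNReal.ofReal_mul (abs_nonneg _), mul_assoc]
    rw [lintegral_congr hsub, lintegral_const_mul' _ _ ENNReal.ofReal_ne_top,
      lintegral_comp_linearMap μ hne', ← mul_assoc, ← ENNReal.ofReal_mul (abs_nonneg _),
      ← abs_mul, mul_inv_cancel₀ hne']
    simp
  · rw [Set.indicator_of_notMem (by exact hw), ← lintegral_zero (μ := μ)]
    refine lintegral_congr_ae ?_
    filter_upwards [ae_det_ne_zero μ LinearMap.id (e := 1) rfl] with A hA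
    have hA' : IsUnit (A⁻¹).det := Matrix.isUnit_nonsing_inv_det _ (isUnit_iff_ne_zero.mpr hA)
    have : h ((A⁻¹)ᴴ * w * A⁻¹) = 0 := not_not.mp fun hc => hw <|
      (Matrix.IsUnit.posDef_star_left_conjugate_iff
        ((Matrix.isUnit_iff_isUnit_det _).mpr hA')).mp (hP _ hc)
    simp [this]

/-- Integration of `f (Aᴴ w A) h w` over `A` and `w`, by the substitution `w ↦ (A⁻¹)ᴴ w A⁻¹` for
fixed `A`. -/
theorem lintegral_lintegral_conj {f h : Matrix (Fin d) (Fin d) ℂ → ℝ≥0∞} (hf : Measurable f)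
    (hh : Measurable h) (hP : ∀ w, h w ≠ 0 → w.PosDef) :
    ∫⁻ w : hermitian d, ∫⁻ A, h w * f (Aᴴ * w * A) ∂μ ∂ν =
      (∫⁻ A, ENNReal.ofReal |(LinearMap.det (LinearMap.mulRight ℝ A))⁻¹| * h ((A⁻¹)ᴴ * A⁻¹) ∂μ) *
        ∫⁻ w : hermitian d, {w | w.PosDef}.indicator f (w : Matrix (Fin d) (Fin d) ℂ) ∂ν := by
  have hdetR : Measurable fun A : Matrix (Fin d) (Fin d) ℂ =>
      ENNReal.ofReal |(LinearMap.det (LinearMap.mulRight ℝ A))⁻¹| :=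
    ENNReal.measurable_ofReal.comp (continuous_det_mulRight.measurable.inv.abs)
  have hunit : ∀ᵐ A ∂μ, IsUnit A.det := by
    filter_upwards [ae_det_ne_zero μ LinearMap.id (e := 1) rfl] with A hA
      using isUnit_iff_ne_zero.mpr hA
  -- the integral over `A`, performed last, does not depend on `w`
  have hJ := lintegral_conj_inv_eq μ hP
  calc ∫⁻ w : hermitian d, ∫⁻ A, h w * f (Aᴴ * w * A) ∂μ ∂ν
        = ∫⁻ A, ∫⁻ w : hermitian d, h w * f (Aᴴ * w * A) ∂ν ∂μ := by
          refine lintegral_lintegral_swap (Measurable.aemeasurable ?_)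
          have hw : Measurable fun p : hermitian d × Matrix (Fin d) (Fin d) ℂ =>
            (p.1 : Matrix (Fin d) (Fin d) ℂ) := measurable_subtype_coe.comp measurable_fst
          exact (hh.comp hw).mul (hf.comp (measurable_conjTranspose_mul_mul measurable_snd hw))
      _ = ∫⁻ A, ∫⁻ w : hermitian d, f w *
            (ENNReal.ofReal |(LinearMap.det (LinearMap.mulRight ℝ A))⁻¹| *
              h ((A⁻¹)ᴴ * w * A⁻¹)) ∂ν ∂μ := by
          refine lintegral_congr_ae ?_
          filter_upwards [hunit] with A hA
          have hdet : LinearMap.det (congrMap A) ≠ 0 := by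
            rw [← abs_ne_zero, abs_det_congrMap, abs_ne_zero]
            exact det_mulRight_ne_zero hA
          have hcancel : ∀ w : hermitian d,
              (A⁻¹)ᴴ * (congrMap A w : Matrix (Fin d) (Fin d) ℂ) * A⁻¹ = w := fun w => by
            rw [coe_congrMap, mul_assoc Aᴴ, ← mul_assoc (A⁻¹)ᴴ, ← conjTranspose_mul,
              Matrix.mul_nonsing_inv _ hA, conjTranspose_one, one_mul,
              Matrix.mul_nonsing_inv_cancel_right _ _ hA]
          have := lintegral_comp_linearMap ν hdet fun w => f w * h ((A⁻¹)ᴴ * w * A⁻¹)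
          simp only [hcancel] at this
          simp only [coe_congrMap] at this
          simp_rw [mul_comm (h _), this, mul_left_comm (f _)]
          rw [lintegral_const_mul' _ _ ENNReal.ofReal_ne_top, abs_inv, abs_det_congrMap, abs_inv]
      _ = ∫⁻ w : hermitian d, ∫⁻ A, f w *
            (ENNReal.ofReal |(LinearMap.det (LinearMap.mulRight ℝ A))⁻¹| *
              h ((A⁻¹)ᴴ * w * A⁻¹)) ∂μ ∂ν := by
          refine lintegral_lintegral_swap (Measurable.aemeasurable ?_)
          have hw : Measurable fun p : Matrix (Fin d) (Fin d) ℂ × hermitian d =>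
            (p.2 : Matrix (Fin d) (Fin d) ℂ) := measurable_subtype_coe.comp measurable_snd
          have hinv : Measurable fun p : Matrix (Fin d) (Fin d) ℂ × hermitian d => p.1⁻¹ :=
            measurable_matrix_inv.comp measurable_fst
          have h1 : Measurable fun p : Matrix (Fin d) (Fin d) ℂ × hermitian d =>
            h ((p.1⁻¹)ᴴ * p.2 * p.1⁻¹) :=
            hh.comp (measurable_conjTranspose_mul_mul hinv hw)
          have h2 : Measurable fun p : Matrix (Fin d) (Fin d) ℂ × hermitian d =>
            ENNReal.ofReal |(LinearMap.det (LinearMap.mulRight ℝ p.1))⁻¹| :=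
            hdetR.comp measurable_fst
          exact (hf.comp hw).mul (h2.mul h1)
      _ = ∫⁻ w : hermitian d, (∫⁻ A, ENNReal.ofReal |(LinearMap.det (LinearMap.mulRight ℝ A))⁻¹| *
              h ((A⁻¹)ᴴ * A⁻¹) ∂μ) *
            {w | w.PosDef}.indicator f (w : Matrix (Fin d) (Fin d) ℂ) ∂ν := by
          refine lintegral_congr fun w => ?_
          rw [lintegral_const_mul, hJ]
          · by_cases hw : (w : Matrix (Fin d) (Fin d) ℂ).PosDef
            · rw [Set.indicator_of_mem (by exact hw), Set.indicator_of_mem (by exact hw), mul_comm]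
            · rw [Set.indicator_of_notMem (by exact hw), Set.indicator_of_notMem (by exact hw),
                mul_zero, mul_zero]
          · exact hdetR.mul (hh.comp
              (measurable_conjTranspose_mul_mul measurable_matrix_inv measurable_const))
      _ = _ := lintegral_const_mul _ ((hf.indicator measurableSet_posDef).comp
          measurable_subtype_coe)

/-- Up to a constant, `G ↦ Gᴴ G` maps Lebesgue measure on square matrices to Lebesgue measure on
the cone of positive definite matrices. Both measures are multiplied by the same factor under the
action `w ↦ Aᴴ w A` of the general linear group, which is transitive on this cone; the constant is
found by integrating `f (Aᴴ w A) h w` in both orders, for a suitable `h`. -/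
theorem exists_lintegral_conjTranspose_mul_self :
    ∃ c : ℝ≥0∞, c ≠ ∞ ∧ ∀ f : Matrix (Fin d) (Fin d) ℂ → ℝ≥0∞, Measurable f →
      ∫⁻ G, f (Gᴴ * G) ∂μ =
        c * ∫⁻ w : hermitian d, {w | w.PosDef}.indicator f (w : Matrix (Fin d) (Fin d) ℂ) ∂ν := by
  obtain ⟨C, hCm, hCP, hC0, hCt, hCμ⟩ := exists_testSet μ ν
  -- The weight on `C` cancels the Jacobian of `A ↦ √w A`.
  let h : Matrix (Fin d) (Fin d) ℂ → ℝ≥0∞ := C.indicator fun w =>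
    ENNReal.ofReal √|LinearMap.det (LinearMap.mulLeft ℝ w)|
  have hh : Measurable h :=
    (ENNReal.measurable_ofReal.comp
      (continuous_det_mulLeft.abs.sqrt.measurable)).indicator hCm
  let Ψ : Matrix (Fin d) (Fin d) ℂ → ℝ≥0∞ := fun A =>
    ENNReal.ofReal |(LinearMap.det (LinearMap.mulRight ℝ A))⁻¹| * h ((A⁻¹)ᴴ * A⁻¹)
  have key : ∀ f : Matrix (Fin d) (Fin d) ℂ → ℝ≥0∞, Measurable f →
      (∫⁻ G, f (Gᴴ * G) ∂μ) * ν (Subtype.val ⁻¹' C) = (∫⁻ A, Ψ A ∂μ) *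
        ∫⁻ w : hermitian d, {w | w.PosDef}.indicator f (w : Matrix (Fin d) (Fin d) ℂ) ∂ν := by
    intro f hf
    calc (∫⁻ G, f (Gᴴ * G) ∂μ) * ν (Subtype.val ⁻¹' C)
        = ∫⁻ w : hermitian d, ∫⁻ A, h w * f (Aᴴ * w * A) ∂μ ∂ν := by
          rw [← lintegral_indicator_const (measurable_subtype_coe hCm)]
          refine lintegral_congr fun w => ?_
          by_cases hw : (w : Matrix (Fin d) (Fin d) ℂ) ∈ C
          · obtain ⟨B, hB, hBu, hBw⟩ := (hCP _ hw).exists_isHermitian_mul_self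
            rw [Set.indicator_of_mem (by exact hw), ← lintegral_conj_eq μ hB hBu hBw f]
            simp only [h, Set.indicator_of_mem hw]
            rw [lintegral_const_mul' _ _ ENNReal.ofReal_ne_top]
          · rw [Set.indicator_of_notMem (by exact hw)]
            simp [h, Set.indicator_of_notMem hw]
      _ = _ := lintegral_lintegral_conj μ ν hf hh fun w hw =>
        hCP w (by_contra fun hc => hw (Set.indicator_of_notMem hc _))
  have hfin : ∫⁻ A, Ψ A ∂μ ≠ ∞ := by
    have h1 := key (C.indicator 1) (measurable_one.indicator hCm)
    have hsub : C ⊆ {w | w.PosDef} := hCP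
    rw [Set.indicator_indicator, Set.inter_eq_right.mpr hsub] at h1
    have h3 : ∫⁻ w : hermitian d, C.indicator 1 (w : Matrix (Fin d) (Fin d) ℂ) ∂ν =
        ν (Subtype.val ⁻¹' C) := lintegral_indicator_one (measurable_subtype_coe hCm)
    have h4 : ∫⁻ G, C.indicator 1 (Gᴴ * G) ∂μ = μ {G | Gᴴ * G ∈ C} :=
      lintegral_indicator_one ((Continuous.measurable (by fun_prop)) hCm)
    rw [h3, h4] at h1
    rwa [← (ENNReal.mul_left_inj hC0 hCt).mp h1]
  refine ⟨(∫⁻ A, Ψ A ∂μ) / ν (Subtype.val ⁻¹' C), ENNReal.div_ne_top hfin hC0, fun f hf => ?_⟩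
  rw [ENNReal.mul_div_right_comm.symm, ← key f hf, ENNReal.mul_div_cancel_right hC0 hCt]

end

/-! ### Densities of Gaussian and Wishart matrices -/

section

theorem complexGaussian_eq_withDensity : ∃ c : ℝ≥0∞, c ≠ ∞ ∧
    complexGaussian = volume.withDensity fun z => c * ENNReal.ofReal (Real.exp (-‖z‖ ^ 2)) := by
  have hpdf : Measurable (gaussianPDF 0 (1 / 2)) := measurable_gaussianPDF _ _
  have hne : (1 / 2 : NNReal) ≠ 0 := by norm_num
  let e := Complex.measurableEquivRealProd.symm
  have he : ⇑e = fun p : ℝ × ℝ => (⟨p.1, p.2⟩ : ℂ) := rfl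
  have hvol : MeasurePreserving e := Complex.volume_preserving_equiv_real_prod.symm
  refine ⟨ENNReal.ofReal ((√Real.pi)⁻¹ ^ 2), ENNReal.ofReal_ne_top, ?_⟩
  refine Measure.ext_of_lintegral _ fun f hf => ?_
  have hfe : Measurable fun p => f (e p) := hf.comp e.measurable
  rw [complexGaussian, gaussianReal_of_var_ne_zero _ hne, prod_withDensity hpdf hpdf, ← he,
    e.measurableEmbedding.lintegral_map, lintegral_withDensity_eq_lintegral_mul _ (by fun_prop)
      hfe, lintegral_withDensity_eq_lintegral_mul _ (by fun_prop) hf,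
    ← hvol.lintegral_comp_emb e.measurableEmbedding]
  refine lintegral_congr fun p => ?_
  have hnorm : ‖e p‖ ^ 2 = p.1 ^ 2 + p.2 ^ 2 := by
    rw [he, Complex.sq_norm, Complex.normSq_mk]
    ring
  simp only [Pi.mul_apply, hnorm]
  congr 1
  rw [gaussianPDF, gaussianPDF, gaussianPDFReal, gaussianPDFReal,
    ← ENNReal.ofReal_mul (by positivity), ← ENNReal.ofReal_mul (by positivity), neg_add,
    Real.exp_add]
  have h1 : 2 * Real.pi * ((1 / 2 : NNReal) : ℝ) = Real.pi := by push_cast; ring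
  have h2 : 2 * ((1 / 2 : NNReal) : ℝ) = 1 := by norm_num
  rw [h1, h2, sub_zero, sub_zero, div_one, div_one]
  congr 1
  ring

/-- Lebesgue measure on the space of `s × d` matrices. -/
def lebesgueMatrix (s d : ℕ) : Measure (Matrix (Fin s) (Fin d) ℂ) :=
  (Measure.pi fun _ : Fin s => Measure.pi fun _ : Fin d => (volume : Measure ℂ)).map Matrix.of

instance instIsAddHaarMeasureLebesgueMatrix (s d : ℕ) : (lebesgueMatrix s d).IsAddHaarMeasure := by
  have : lebesgueMatrix s d =
      Measure.pi fun _ : Fin s => Measure.pi fun _ : Fin d => (volume : Measure ℂ) :=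
    Measure.map_id
  rw [this]
  have h1 : (Measure.pi fun _ : Fin d => (volume : Measure ℂ)).IsAddHaarMeasure := inferInstance
  exact Measure.pi.isAddHaarMeasure fun _ : Fin s =>
    Measure.pi fun _ : Fin d => (volume : Measure ℂ)

/-- The unnormalized Gaussian weight `exp (-tr w)`. -/
def expNegTrace {d : ℕ} (w : Matrix (Fin d) (Fin d) ℂ) : ℝ≥0∞ :=
  ENNReal.ofReal (Real.exp (-w.trace.re))

theorem measurable_expNegTrace {d : ℕ} : Measurable (expNegTrace (d := d)) := by
  have : Continuous fun w : Matrix (Fin d) (Fin d) ℂ => Real.exp (-w.trace.re) :=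
    Real.continuous_exp.comp (Complex.continuous_re.comp (continuous_id.matrix_trace)).neg
  exact this.measurable.ennreal_ofReal

theorem prod_expNegTrace {d k : ℕ} (w : Fin k → Matrix (Fin d) (Fin d) ℂ) :
    ∏ i, expNegTrace (w i) = expNegTrace (∑ i, w i) := by
  simp only [expNegTrace]
  rw [← ENNReal.ofReal_prod_of_nonneg fun _ _ => (Real.exp_pos _).le, ← Real.exp_sum,
    trace_sum, Complex.re_sum, Finset.sum_neg_distrib]

theorem expNegTrace_ne_top {d : ℕ} (w : Matrix (Fin d) (Fin d) ℂ) : expNegTrace w ≠ ∞ :=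
  ENNReal.ofReal_ne_top

theorem expNegTrace_conjTranspose_mul_self {s d : ℕ} (G : Matrix (Fin s) (Fin d) ℂ) :
    expNegTrace (Gᴴ * G) = ∏ i, ∏ j, ENNReal.ofReal (Real.exp (-‖G i j‖ ^ 2)) := by
  have htr : (Gᴴ * G).trace.re = ∑ i, ∑ j, ‖G i j‖ ^ 2 := by
    rw [Finset.sum_comm]
    simp [Matrix.trace, mul_apply, conjTranspose_apply, Complex.conj_mul', ← Complex.ofReal_pow]
  rw [expNegTrace, htr, ← Finset.sum_neg_distrib, Real.exp_sum,
    ENNReal.ofReal_prod_of_nonneg fun _ _ => (Real.exp_pos _).le]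
  refine Finset.prod_congr rfl fun i _ => ?_
  rw [← Finset.sum_neg_distrib, Real.exp_sum,
    ENNReal.ofReal_prod_of_nonneg fun _ _ => (Real.exp_pos _).le]

theorem ginibre_eq_withDensity (s d : ℕ) : ∃ c : ℝ≥0∞, c ≠ ∞ ∧
    ginibre s d = (lebesgueMatrix s d).withDensity fun G => c * expNegTrace (Gᴴ * G) := by
  obtain ⟨c, hc, h⟩ := complexGaussian_eq_withDensity
  let g : ℂ → ℝ≥0∞ := fun z => c * ENNReal.ofReal (Real.exp (-‖z‖ ^ 2))
  have hg : Measurable g := by fun_prop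
  have hg' : ∀ z, g z ≠ ∞ := fun z => ENNReal.mul_ne_top hc ENNReal.ofReal_ne_top
  refine ⟨(c ^ d) ^ s, by finiteness, ?_⟩
  have hleb : lebesgueMatrix s d =
      Measure.pi fun _ : Fin s => Measure.pi fun _ : Fin d => (volume : Measure ℂ) :=
    Measure.map_id
  have hgin : ginibre s d =
      Measure.pi fun _ : Fin s => Measure.pi fun _ : Fin d => complexGaussian :=
    Measure.map_id
  have hgp : Measurable fun x : Fin d → ℂ => ∏ i, g (x i) :=
    Finset.measurable_prod _ fun i _ => hg.comp (measurable_pi_apply i)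
  rw [hgin, hleb, h]
  refine (congrArg (fun m => Measure.pi fun _ : Fin s => m) (pi_withDensity volume hg hg')).trans
    ((pi_withDensity _ hgp fun x => ENNReal.prod_ne_top fun i _ => hg' _).trans ?_)
  congr 1
  funext G
  simp only [g, Finset.prod_mul_distrib, Finset.prod_const, Finset.card_univ, Fintype.card_fin]
  congr 1
  exact (expNegTrace_conjTranspose_mul_self G).symm

instance instIsProbabilityMeasureComplexGaussian : IsProbabilityMeasure complexGaussian :=
  Measure.isProbabilityMeasure_map
    (Complex.measurableEquivRealProd.symm.measurable.aemeasurable)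

instance instIsProbabilityMeasureGinibre (s d : ℕ) : IsProbabilityMeasure (ginibre s d) :=
  Measure.isProbabilityMeasure_map (f := Matrix.of) measurable_id.aemeasurable

theorem measurable_conjTranspose_mul_self {s d : ℕ} :
    Measurable fun G : Matrix (Fin s) (Fin d) ℂ => Gᴴ * G :=
  Continuous.measurable (by fun_prop)

instance instIsProbabilityMeasureWishart (d s : ℕ) : IsProbabilityMeasure (wishart d s) :=
  Measure.isProbabilityMeasure_map measurable_conjTranspose_mul_self.aemeasurable

/-- The square Wishart distribution has density proportional to `exp (-tr w)` on the cone of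
positive semidefinite matrices. -/
theorem wishart_self_eq_map_withDensity {d : ℕ} (ν : Measure (hermitian d)) [ν.IsAddHaarMeasure] :
    ∃ c : ℝ≥0∞, c ≠ ∞ ∧ wishart d d = (ν.withDensity fun w =>
      c * {w | w.PosSemidef}.indicator expNegTrace (w : Matrix (Fin d) (Fin d) ℂ)).map
        Subtype.val := by
  obtain ⟨c, hc, h⟩ := ginibre_eq_withDensity d d
  obtain ⟨b, hb, hμ⟩ := exists_lintegral_conjTranspose_mul_self (lebesgueMatrix d d) ν
  have hm : Measurable fun w : hermitian d =>
      {w | w.PosSemidef}.indicator expNegTrace (w : Matrix (Fin d) (Fin d) ℂ) :=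
    (measurable_expNegTrace.indicator isClosed_posSemidef.measurableSet).comp
      measurable_subtype_coe
  refine ⟨c * b, ENNReal.mul_ne_top hc hb, Measure.ext_of_lintegral _ fun f hf => ?_⟩
  have hfG : Measurable fun G : Matrix (Fin d) (Fin d) ℂ => f (Gᴴ * G) :=
    hf.comp measurable_conjTranspose_mul_self
  have hcG : Measurable fun G : Matrix (Fin d) (Fin d) ℂ => c * expNegTrace (Gᴴ * G) :=
    (measurable_expNegTrace.comp measurable_conjTranspose_mul_self).const_mul c
  have hfw : Measurable fun w : hermitian d => f w := hf.comp measurable_subtype_coe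
  rw [wishart, lintegral_map hf measurable_conjTranspose_mul_self, h,
    lintegral_map hf measurable_subtype_coe,
    lintegral_withDensity_eq_lintegral_mul _ hcG hfG,
    lintegral_withDensity_eq_lintegral_mul _ (hm.const_mul _) hfw]
  have := hμ (fun w => expNegTrace w * f w) (measurable_expNegTrace.mul hf)
  simp only [Pi.mul_apply, mul_assoc]
  rw [lintegral_const_mul' _ _ hc, this, lintegral_const_mul' _ _ hc, lintegral_const_mul' _ _ hb]
  congr 2
  refine lintegral_congr_ae ?_
  filter_upwards [ae_det_ne_zero ν (hermitian d).subtype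
    (e := ⟨1, mem_hermitian.mpr isHermitian_one⟩) rfl] with w hw
  by_cases hp : (w : Matrix (Fin d) (Fin d) ℂ).PosSemidef
  · have hp' : (w : Matrix (Fin d) (Fin d) ℂ).PosDef := hp.posDef_iff_det_ne_zero.mpr hw
    rw [Set.indicator_of_mem (by exact hp'), Set.indicator_of_mem (by exact hp)]
  · rw [Set.indicator_of_notMem (by exact fun h : PosDef _ => hp h.posSemidef),
      Set.indicator_of_notMem (by exact hp), zero_mul]

end

/-! ### Normalization of independent Wishart matrices -/

section

variable {d k : ℕ}

theorem isClosed_zeroSumHermitian :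
    IsClosed (zeroSumHermitian d k : Set (Fin k → Matrix (Fin d) (Fin d) ℂ)) := by
  have h : (zeroSumHermitian d k : Set (Fin k → Matrix (Fin d) (Fin d) ℂ)) =
      (⋂ i, {x | (x i)ᴴ = x i}) ∩ {x | ∑ i, x i = 0} := by
    ext x
    simp [zeroSumHermitian, IsHermitian]
  rw [h]
  exact (isClosed_iInter fun i => isClosed_eq (by fun_prop) (by fun_prop)).inter
    (isClosed_eq (by fun_prop) (by fun_prop))

instance instLocallyCompactSpaceZeroSum : LocallyCompactSpace (zeroSumHermitian d k) :=
  isClosed_zeroSumHermitian.isClosedEmbedding_subtypeVal.locallyCompactSpace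

instance instSecondCountableTopologyZeroSum :
    SecondCountableTopology (zeroSumHermitian d k) :=
  TopologicalSpace.Subtype.secondCountableTopology _

theorem isClosed_forall_posSemidef :
    IsClosed {W : Fin k → Matrix (Fin d) (Fin d) ℂ | ∀ i, (W i).PosSemidef} := by
  have h : ∀ i : Fin k, IsClosed ((fun W : Fin k → Matrix (Fin d) (Fin d) ℂ => W i) ⁻¹'
      {w | w.PosSemidef}) := fun i => isClosed_posSemidef.preimage (continuous_apply i)
  convert isClosed_iInter h using 1
  ext W
  simp

theorem isClosed_povmSet : IsClosed (povmSet d k) := by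
  have h : IsClosed {x : Fin k → Matrix (Fin d) (Fin d) ℂ | ∑ i, x i = 1} :=
    isClosed_eq (by fun_prop) (by fun_prop)
  exact isClosed_forall_posSemidef.inter h

theorem isCompact_povmSet : IsCompact (povmSet d k) := by
  refine (isCompact_univ_pi fun _ : Fin k => isCompact_norm_entry_le (d := d) 1).of_isClosed_subset
    isClosed_povmSet fun m hm i _ a b => ?_
  have hdiag : ∀ a, ‖m i a a‖ ≤ 1 := fun a => by
    have h0 : ∀ j, 0 ≤ m j a a := fun j => (hm.1 j).diag_nonneg
    have h1 : ∑ j, m j a a = 1 := by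
      rw [← Matrix.sum_apply, hm.2, one_apply_eq]
    have h2 : m i a a ≤ 1 := h1 ▸ Finset.single_le_sum (f := fun j => m j a a)
      (fun j _ => h0 j) (Finset.mem_univ i)
    rw [← (Complex.abs_re_eq_norm.mpr (Complex.nonneg_iff.mp (h0 i)).2.symm),
      abs_of_nonneg (Complex.nonneg_iff.mp (h0 i)).1]
    exact (Complex.le_def.mp h2).1
  linarith [(hm.1 i).norm_apply_le a b, hdiag a, hdiag b]

theorem measurable_normalizeTuple : Measurable (normalizeTuple (d := d) (k := k)) := by
  refine measurable_pi_lambda _ fun i => ?_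
  have hS : Measurable fun W : Fin k → Matrix (Fin d) (Fin d) ℂ => invSqrt (∑ j, W j) :=
    measurable_invSqrt.comp (Continuous.measurable (by fun_prop))
  have hW : Measurable fun W : Fin k → Matrix (Fin d) (Fin d) ℂ => W i := measurable_pi_apply i
  have := measurable_conjTranspose_mul_mul hS hW
  simp only [(invSqrt_isHermitian _).eq] at this
  exact this

/-- The action `x ↦ (Aᴴ x₁ A, …, Aᴴ x_k A)` on `k`-tuples of Hermitian matrices with sum zero. -/
def congrMapZeroSum (A : Matrix (Fin d) (Fin d) ℂ) :
    zeroSumHermitian d k →ₗ[ℝ] zeroSumHermitian d k where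
  toFun x := ⟨fun i => Aᴴ * x.1 i * A, fun i => isHermitian_conjTranspose_mul_mul A (x.2.1 i), by
    rw [← Finset.sum_mul, ← Finset.mul_sum, x.2.2, mul_zero, zero_mul]⟩
  map_add' x y := by ext1; funext i; simp [mul_add, add_mul]
  map_smul' c x := by ext1; funext i; simp

theorem coe_congrMapZeroSum (A : Matrix (Fin d) (Fin d) ℂ) (x : zeroSumHermitian d k) (i : Fin k) :
    (congrMapZeroSum A x : Fin k → Matrix (Fin d) (Fin d) ℂ) i = Aᴴ * x.1 i * A := rfl

theorem det_congrMapZeroSum_ne_zero {A : Matrix (Fin d) (Fin d) ℂ} (hA : IsUnit A.det) :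
    LinearMap.det (congrMapZeroSum (k := k) A) ≠ 0 := by
  have h : congrMapZeroSum (k := k) A ∘ₗ congrMapZeroSum A⁻¹ = LinearMap.id := by
    refine LinearMap.ext fun x => ?_
    ext1
    funext i
    simp only [LinearMap.comp_apply, coe_congrMapZeroSum, LinearMap.id_apply]
    rw [mul_assoc (A⁻¹)ᴴ, ← mul_assoc Aᴴ, ← conjTranspose_mul, Matrix.nonsing_inv_mul _ hA,
      conjTranspose_one, one_mul, Matrix.nonsing_inv_mul_cancel_right _ _ hA]
  have := congrArg LinearMap.det h
  rw [LinearMap.det_comp, LinearMap.det_id] at this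
  exact left_ne_zero_of_mul (this ▸ one_ne_zero)

/-- A `k`-tuple of Hermitian matrices amounts to its sum `S` and a `k`-tuple with sum zero, its
difference with the tuple `(S/k, …, S/k)`. -/
def sumZeroSumEquiv (hk : 0 < k) :
    (hermitian d × zeroSumHermitian d k) ≃ₗ[ℝ] (Fin k → hermitian d) where
  toFun p i := ⟨p.2.1 i, p.2.2.1 i⟩ + (k : ℝ)⁻¹ • p.1
  map_add' p q := by funext i; ext1; simp; abel
  map_smul' c p := by funext i; ext1; simp [smul_comm c]
  invFun W := (∑ j, W j, ⟨fun i => W i - (k : ℝ)⁻¹ • ∑ j, W j, fun i => by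
      have := (W i - (k : ℝ)⁻¹ • ∑ j, W j).2
      rw [← mem_hermitian]
      simpa using this, by
      have : (k : ℝ) ≠ 0 := by positivity
      simp [Finset.sum_sub_distrib, ← Nat.cast_smul_eq_nsmul ℝ, smul_smul, this]⟩)
  left_inv p := by
    have hk' : (k : ℝ) ≠ 0 := by positivity
    have hs : ∑ j, ((⟨p.2.1 j, p.2.2.1 j⟩ : hermitian d) + (k : ℝ)⁻¹ • p.1) = p.1 := by
      ext1
      simp [Finset.sum_add_distrib, ← Nat.cast_smul_eq_nsmul ℝ, smul_smul, hk', p.2.2.2]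
    ext1
    · exact hs
    · ext1
      funext i
      simp [hs]
  right_inv W := by
    funext i
    ext1
    simp

theorem coe_sumZeroSumEquiv (hk : 0 < k) (p : hermitian d × zeroSumHermitian d k) (i : Fin k) :
    (sumZeroSumEquiv hk p i : Matrix (Fin d) (Fin d) ℂ) = p.2.1 i + (k : ℝ)⁻¹ • p.1 := by
  simp [sumZeroSumEquiv]

theorem sum_sumZeroSumEquiv (hk : 0 < k) (p : hermitian d × zeroSumHermitian d k) :
    ∑ i, (sumZeroSumEquiv hk p i : Matrix (Fin d) (Fin d) ℂ) = p.1 := by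
  have := congrArg Prod.fst ((sumZeroSumEquiv hk).symm_apply_apply p)
  rw [← this]
  simp [sumZeroSumEquiv]

variable (vol : Measure (zeroSumHermitian d k)) [vol.IsAddHaarMeasure]

theorem measurable_translate :
    Measurable fun (x : zeroSumHermitian d k) (i : Fin k) =>
      (x : Fin k → Matrix (Fin d) (Fin d) ℂ) i + ((k : ℂ)⁻¹) • (1 : Matrix (Fin d) (Fin d) ℂ) := by
  refine Continuous.measurable (continuous_pi fun i => Continuous.add ?_ continuous_const)
  exact (continuous_apply i).comp continuous_subtype_val

theorem affineLebesgue_povmSet_ne_top : affineLebesgue vol (povmSet d k) ≠ ∞ := by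
  rw [affineLebesgue, Measure.map_apply measurable_translate isClosed_povmSet.measurableSet]
  have h1 : IsCompact ((fun x : Fin k → Matrix (Fin d) (Fin d) ℂ => x + fun _ =>
      ((k : ℂ)⁻¹) • (1 : Matrix (Fin d) (Fin d) ℂ)) ⁻¹' povmSet d k) :=
    (Homeomorph.addRight _).isCompact_preimage.mpr isCompact_povmSet
  exact (isClosed_zeroSumHermitian.isClosedEmbedding_subtypeVal.isCompact_preimage
    h1).measure_lt_top.ne

/-- For a tuple with positive definite sum `S`, being positive semidefinite and being normalized into
`B` both depend only on the normalized tuple, which is affine in the zero-sum part `x`. -/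
theorem indicator_normalizeTuple (hk : 0 < k) {S : hermitian d}
    (hS : (S : Matrix (Fin d) (Fin d) ℂ).PosDef) (x : zeroSumHermitian d k)
    (B : Set (Fin k → Matrix (Fin d) (Fin d) ℂ)) :
    {W | (∀ i, (W i).PosSemidef) ∧ normalizeTuple W ∈ B}.indicator
      (1 : (Fin k → Matrix (Fin d) (Fin d) ℂ) → ℝ≥0∞)
      (fun i => (sumZeroSumEquiv hk (S, x) i : Matrix (Fin d) (Fin d) ℂ)) =
    (B ∩ povmSet d k).indicator 1 fun i => (congrMapZeroSum (invSqrt S.1) x :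
      Fin k → Matrix (Fin d) (Fin d) ℂ) i + ((k : ℂ)⁻¹) • (1 : Matrix (Fin d) (Fin d) ℂ) := by
  have hR : (invSqrt S.1)ᴴ = invSqrt S.1 := invSqrt_isHermitian _
  set W : Fin k → Matrix (Fin d) (Fin d) ℂ := fun i => sumZeroSumEquiv hk (S, x) i with hW
  have hsum : ∑ i, W i = S.1 := sum_sumZeroSumEquiv hk (S, x)
  have hnorm : (fun i => (congrMapZeroSum (invSqrt S.1) x : Fin k → Matrix (Fin d) (Fin d) ℂ) i +
      ((k : ℂ)⁻¹) • (1 : Matrix (Fin d) (Fin d) ℂ)) = normalizeTuple W := by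
    funext i
    have hWi : W i = x.1 i + (k : ℝ)⁻¹ • S.1 := coe_sumZeroSumEquiv hk (S, x) i
    rw [normalizeTuple, hsum, hWi, coe_congrMapZeroSum, hR, mul_add, add_mul,
      mul_smul_comm, smul_mul_assoc, hS.invSqrt_mul_self]
    congr 1
    ext a b
    simp
  have hiff : (∀ i, (W i).PosSemidef) ↔ normalizeTuple W ∈ povmSet d k := by
    have hu : IsUnit (invSqrt S.1) := (isUnit_iff_isUnit_det _).mpr hS.isUnit_det_invSqrt
    have h1 : ∑ i, normalizeTuple W i = 1 := by
      simp only [normalizeTuple]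
      rw [← Finset.sum_mul, ← Finset.mul_sum, hsum, hS.invSqrt_mul_self]
    have h2 : ∀ i, (normalizeTuple W i).PosSemidef ↔ (W i).PosSemidef := fun i => by
      have := hu.posSemidef_star_left_conjugate_iff (x := W i)
      rwa [star_eq_conjTranspose, hR, ← hsum] at this
    simp only [povmSet, Set.mem_ofPred_eq, h1, h2, and_true]
  rw [hnorm]
  by_cases h : normalizeTuple W ∈ B ∩ povmSet d k
  · rw [Set.indicator_of_mem h, Set.indicator_of_mem (by exact ⟨hiff.mpr h.2, h.1⟩)]
    rfl
  · rw [Set.indicator_of_notMem h, Set.indicator_of_notMem fun h' => h ⟨h'.2, hiff.mp h'.1⟩]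

/-- For a fixed invertible `S`, tuples with sum `S` are normalized by a linear substitution on
tuples with sum zero. It preserves positivity, and maps Lebesgue measure to a multiple of itself. -/
theorem exists_lintegral_normalizeTuple (hk : 0 < k) {S : hermitian d}
    (hS : (S : Matrix (Fin d) (Fin d) ℂ).det ≠ 0) :
    ∃ c : ℝ≥0∞, ∀ B : Set (Fin k → Matrix (Fin d) (Fin d) ℂ), MeasurableSet B →
      ∫⁻ x, {W | (∀ i, (W i).PosSemidef) ∧ normalizeTuple W ∈ B}.indicator 1
        (fun i => (sumZeroSumEquiv hk (S, x) i : Matrix (Fin d) (Fin d) ℂ)) ∂vol =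
          c * affineLebesgue vol (B ∩ povmSet d k) := by
  by_cases hp : (S : Matrix (Fin d) (Fin d) ℂ).PosDef
  · let L := congrMapZeroSum (k := k) (invSqrt S.1)
    refine ⟨ENNReal.ofReal |(LinearMap.det L)⁻¹|, fun B hB => ?_⟩
    have hm := hB.inter (isClosed_povmSet (d := d) (k := k)).measurableSet
    rw [affineLebesgue, ← lintegral_indicator_one hm,
      lintegral_map (measurable_one.indicator hm) measurable_translate,
      ← lintegral_comp_linearMap vol (det_congrMapZeroSum_ne_zero hp.isUnit_det_invSqrt)]
    exact lintegral_congr fun x => indicator_normalizeTuple hk hp x B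
  · refine ⟨0, fun B _ => ?_⟩
    rw [zero_mul, ← lintegral_zero (μ := vol)]
    refine lintegral_congr fun x => Set.indicator_of_notMem (fun h => hp ?_) _
    have := sum_sumZeroSumEquiv hk (S, x)
    refine Matrix.PosSemidef.posDef_iff_det_ne_zero (this ▸ ?_) |>.mpr hS
    exact posSemidef_sum _ fun i _ => h.1 i

/-- The law of a square Wishart-random POVM is proportional to Lebesgue measure on the set of POVMs:
conditionally on the sum of the Wishart matrices, it is so by the previous substitution. -/
theorem exists_wishartPOVM_apply (hk : 0 < k) :
    ∃ K : ℝ≥0∞, ∀ B : Set (Fin k → Matrix (Fin d) (Fin d) ℂ), MeasurableSet B →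
      wishartPOVM d k (fun _ => d) B = K * affineLebesgue vol (B ∩ povmSet d k) := by
  let ν : Measure (hermitian d) := Measure.addHaar
  obtain ⟨c, hc, hwish⟩ := wishart_self_eq_map_withDensity ν
  let g : hermitian d → ℝ≥0∞ := fun w => c * {w | w.PosSemidef}.indicator expNegTrace w.1
  have hg : Measurable g := ((measurable_expNegTrace.indicator
    isClosed_posSemidef.measurableSet).comp measurable_subtype_coe).const_mul c
  have hgt : ∀ w, g w ≠ ∞ := fun w => ENNReal.mul_ne_top hc
    (ne_top_of_le_ne_top (expNegTrace_ne_top w.1) (Set.indicator_le_self _ _ _))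
  let e := (sumZeroSumEquiv (d := d) hk).toContinuousLinearEquiv
  -- uniqueness of Lebesgue measure, in the coordinates given by the sum and the zero-sum part
  obtain ⟨a, ha⟩ : ∃ a : ℝ≥0∞, (Measure.pi fun _ : Fin k => ν) = a • (ν.prod vol).map e := by
    have : ((ν.prod vol).map e).IsAddHaarMeasure := e.isAddHaarMeasure_map _
    exact ⟨_, Measure.isAddLeftInvariant_eq_smul _ _⟩
  have hq : ∀ S : hermitian d, ∃ q : ℝ≥0∞, S.1.det ≠ 0 → ∀ B, MeasurableSet B →
      ∫⁻ x, {W | (∀ i, (W i).PosSemidef) ∧ normalizeTuple W ∈ B}.indicator 1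
        (fun i => (sumZeroSumEquiv hk (S, x) i : Matrix (Fin d) (Fin d) ℂ)) ∂vol =
          q * affineLebesgue vol (B ∩ povmSet d k) := fun S => by
    by_cases hS : S.1.det = 0
    · exact ⟨0, fun h => absurd hS h⟩
    · obtain ⟨q, hq⟩ := exists_lintegral_normalizeTuple vol hk hS
      exact ⟨q, fun _ => hq⟩
  choose q hq using hq
  refine ⟨a * ∫⁻ S, c ^ k * expNegTrace S.1 * q S ∂ν, fun B hB => ?_⟩
  set T : Set (Fin k → Matrix (Fin d) (Fin d) ℂ) :=
    {W | (∀ i, (W i).PosSemidef) ∧ normalizeTuple W ∈ B}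
  have hTm : MeasurableSet T := by
    exact isClosed_forall_posSemidef.measurableSet.inter (measurable_normalizeTuple hB)
  have hcoe : Measurable fun (x : Fin k → hermitian d) (i : Fin k) => (x i).1 :=
    measurable_pi_lambda _ fun i => measurable_subtype_coe.comp (measurable_pi_apply i)
  calc wishartPOVM d k (fun _ => d) B
      = ∫⁻ x : Fin k → hermitian d, T.indicator 1 (fun i => (x i).1) *
          (c ^ k * expNegTrace (∑ i, (x i).1)) ∂(Measure.pi fun _ : Fin k => ν) := by
        have hp : IsProbabilityMeasure ((ν.withDensity g).map Subtype.val) :=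
          hwish ▸ inferInstance
        have hpre : MeasurableSet {x : Fin k → hermitian d |
            normalizeTuple (fun i => (x i).1) ∈ B} := hcoe (measurable_normalizeTuple hB)
        rw [wishartPOVM, Measure.map_apply measurable_normalizeTuple hB]
        simp_rw [hwish]
        rw [← Measure.pi_map_pi (fun _ => measurable_subtype_coe.aemeasurable),
          Measure.map_apply hcoe (measurable_normalizeTuple hB), pi_withDensity ν hg hgt]
        refine (withDensity_apply _ hpre).trans ?_
        rw [← lintegral_indicator hpre]
        refine lintegral_congr fun x => ?_
        by_cases hx : ∀ i, (x i).1.PosSemidef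
        · have hprod : ∏ i, g (x i) = c ^ k * expNegTrace (∑ i, (x i).1) := by
            have hgi : ∀ i, g (x i) = c * expNegTrace (x i).1 := fun i =>
              congrArg (c * ·) (Set.indicator_of_mem (by exact hx i) _)
            rw [← prod_expNegTrace, Finset.prod_congr rfl fun i _ => hgi i,
              Finset.prod_mul_distrib, Finset.prod_const, Finset.card_univ, Fintype.card_fin]
          by_cases hxB : normalizeTuple (fun i => (x i).1) ∈ B
          · rw [Set.indicator_of_mem (by exact hxB), Set.indicator_of_mem (by exact ⟨hx, hxB⟩),
              hprod, Pi.one_apply, one_mul]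
          · rw [Set.indicator_of_notMem (by exact hxB),
              Set.indicator_of_notMem (by exact fun h => hxB h.2), zero_mul]
        · rw [Set.indicator_of_notMem (a := fun i => (x i).1) (by exact fun h => hx h.1), zero_mul]
          obtain ⟨i, hi⟩ := not_forall.mp hx
          refine Set.indicator_apply_eq_zero.mpr fun _ =>
            Finset.prod_eq_zero (Finset.mem_univ i) ?_
          simp only [g]
          rw [Set.indicator_of_notMem (by exact hi), mul_zero]
    _ = a * ∫⁻ S, ∫⁻ x, T.indicator 1 (fun i => (sumZeroSumEquiv hk (S, x) i).1) *
          (c ^ k * expNegTrace S.1) ∂vol ∂ν := by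
        have hmeas : Measurable fun p : hermitian d × zeroSumHermitian d k =>
            T.indicator 1 (fun i => (e p i).1) * (c ^ k * expNegTrace (∑ i, (e p i).1)) := by
          have he : Measurable fun (p : hermitian d × zeroSumHermitian d k) i => (e p i).1 :=
            hcoe.comp e.continuous.measurable
          have hs : Measurable fun p : hermitian d × zeroSumHermitian d k => ∑ i, (e p i).1 :=
            Finset.measurable_sum _ fun i _ => (measurable_pi_apply i).comp he
          exact ((measurable_one.indicator hTm).comp he).mul
            ((measurable_expNegTrace.comp hs).const_mul _)
        have hem : MeasurableEmbedding e := e.toHomeomorph.measurableEmbedding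
        rw [ha, lintegral_smul_measure, hem.lintegral_map, lintegral_prod _ hmeas.aemeasurable,
          smul_eq_mul]
        congr 1
        refine lintegral_congr fun S => lintegral_congr fun x => ?_
        rw [← sum_sumZeroSumEquiv hk (S, x)]
        rfl
    _ = a * ∫⁻ S, c ^ k * expNegTrace S.1 * q S * affineLebesgue vol (B ∩ povmSet d k) ∂ν := by
        congr 1
        refine lintegral_congr_ae ?_
        filter_upwards [ae_det_ne_zero ν (hermitian d).subtype
          (e := ⟨1, mem_hermitian.mpr isHermitian_one⟩) rfl] with S hS
        rw [lintegral_mul_const' _ _ (by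
          have := expNegTrace_ne_top S.1
          finiteness), hq S hS B hB]
        ring
    _ = _ := by
        rw [lintegral_mul_const' _ _ (ne_top_of_le_ne_top (affineLebesgue_povmSet_ne_top vol)
          (measure_mono Set.inter_subset_right)), mul_assoc]

end

/-! ### Unitary invariance and Haar-random isometries -/

section

variable {d k : ℕ}

instance instIsProbabilityMeasureHaarUnitary {ι : Type*} [Fintype ι] [DecidableEq ι] :
    IsProbabilityMeasure (haarUnitary ι) :=
  ⟨by simpa [haarUnitary] using Measure.haarMeasure_self (G := Matrix.unitaryGroup ι ℂ) (K₀ := ⊤)⟩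

instance instIsHaarMeasureHaarUnitary {ι : Type*} [Fintype ι] [DecidableEq ι] :
    (haarUnitary ι).IsHaarMeasure :=
  Measure.isHaarMeasure_haarMeasure ⊤

/-- The Haar measure of the compact group of unitary matrices is also right invariant. -/
theorem map_mul_right_haarUnitary {ι : Type*} [Fintype ι] [DecidableEq ι]
    (u : Matrix.unitaryGroup ι ℂ) : (haarUnitary ι).map (· * u) = haarUnitary ι := by
  have : IsProbabilityMeasure ((haarUnitary ι).map (· * u)) :=
    Measure.isProbabilityMeasure_map (measurable_mul_const u).aemeasurable
  exact Measure.isHaarMeasure_eq_of_isProbabilityMeasure _ _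

/-- Every isometry consists of columns of a unitary matrix. -/
theorem exists_unitary_submatrix {ι κ : Type*} [Fintype ι] [DecidableEq ι] [Fintype κ]
    [DecidableEq κ] {φ : κ → ι} (hφ : Function.Injective φ) {V : Matrix ι κ ℂ} (hV : Vᴴ * V = 1) :
    ∃ u : Matrix.unitaryGroup ι ℂ, (u : Matrix ι ι ℂ).submatrix id φ = V := by
  let col : κ → EuclideanSpace ℂ ι := fun j => WithLp.toLp 2 fun a => V a j
  have hcol : Orthonormal ℂ col := by
    rw [orthonormal_iff_ite]
    intro i j
    have := congrFun (congrFun hV i) j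
    rw [mul_apply, one_apply] at this
    rw [← this, PiLp.inner_apply]
    exact Finset.sum_congr rfl fun a _ => by simp [col, mul_comm]
  have hs : Orthonormal ℂ ((Set.range φ).domRestrict (Function.extend φ col 0)) := by
    convert hcol.comp _ (Equiv.ofInjective φ hφ).symm.injective using 1
    funext p
    obtain ⟨j, hj⟩ := (Equiv.ofInjective φ hφ).surjective p
    rw [← hj]
    simp [Set.domRestrict_apply, hφ.extend_apply]
  obtain ⟨b, hb⟩ := hs.exists_orthonormalBasis_extension_of_card_eq (by simp)
  refine ⟨⟨_, (EuclideanSpace.basisFun ι ℂ).toMatrix_orthonormalBasis_mem_unitary b⟩, ?_⟩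
  ext a j
  have := hb (φ j) ⟨j, rfl⟩
  rw [hφ.extend_apply] at this
  simp [Module.Basis.toMatrix_apply, this, col]

theorem measurable_haarIsometry_map (d k n : ℕ) (h : d ≤ k * n) :
    Measurable fun U : Matrix.unitaryGroup (Fin k × Fin n) ℂ =>
      (U : Matrix (Fin k × Fin n) (Fin k × Fin n) ℂ).submatrix id
        fun j => finProdFinEquiv.symm (Fin.castLE h j) :=
  (continuous_subtype_val.matrix_submatrix _ _).measurable

/-- The law of a Haar-random isometry is the only probability measure on isometries that is
invariant under multiplication by unitary matrices on the left. -/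
theorem eq_haarIsometry {d k n : ℕ} (h : d ≤ k * n)
    (ξ : Measure (Matrix (Fin k × Fin n) (Fin d) ℂ)) [IsProbabilityMeasure ξ]
    (hinv : ∀ u : Matrix.unitaryGroup (Fin k × Fin n) ℂ,
      ξ.map (fun V => (u : Matrix (Fin k × Fin n) (Fin k × Fin n) ℂ) * V) = ξ)
    (hiso : ∀ᵐ V ∂ξ, Vᴴ * V = 1) : ξ = haarIsometry d k n h := by
  refine Measure.ext_of_lintegral _ fun f hf => ?_
  have hc : Continuous fun p : Matrix.unitaryGroup (Fin k × Fin n) ℂ ×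
      Matrix (Fin k × Fin n) (Fin d) ℂ =>
      (p.1 : Matrix (Fin k × Fin n) (Fin k × Fin n) ℂ) * p.2 := by fun_prop
  have hm := hf.comp hc.measurable
  calc ∫⁻ V, f V ∂ξ
      = ∫⁻ _ : Matrix.unitaryGroup (Fin k × Fin n) ℂ, ∫⁻ V, f V ∂ξ
          ∂(haarUnitary (Fin k × Fin n)) := by simp
    _ = ∫⁻ u : Matrix.unitaryGroup (Fin k × Fin n) ℂ, ∫⁻ V,
          f ((u : Matrix (Fin k × Fin n) (Fin k × Fin n) ℂ) * V) ∂ξ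
          ∂(haarUnitary (Fin k × Fin n)) := by
        refine lintegral_congr fun u => ?_
        conv_lhs => rw [← hinv u]
        exact lintegral_map hf (Continuous.measurable (by fun_prop))
    _ = ∫⁻ V, ∫⁻ u : Matrix.unitaryGroup (Fin k × Fin n) ℂ,
          f ((u : Matrix (Fin k × Fin n) (Fin k × Fin n) ℂ) * V)
          ∂(haarUnitary (Fin k × Fin n)) ∂ξ := lintegral_lintegral_swap hm.aemeasurable
    _ = ∫⁻ V, ∫⁻ V', f V' ∂(haarIsometry d k n h) ∂ξ := by
        refine lintegral_congr_ae ?_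
        filter_upwards [hiso] with V hV
        have hφ : Function.Injective fun j => finProdFinEquiv.symm (Fin.castLE h j) :=
          finProdFinEquiv.symm.injective.comp (Fin.castLE_injective h)
        obtain ⟨w, rfl⟩ := exists_unitary_submatrix hφ hV
        have hmap := measurable_haarIsometry_map d k n h
        rw [haarIsometry, lintegral_map hf hmap]
        conv_rhs => rw [← map_mul_right_haarUnitary w]
        have hfmap : Measurable fun U : Matrix.unitaryGroup (Fin k × Fin n) ℂ =>
            f ((U : Matrix (Fin k × Fin n) (Fin k × Fin n) ℂ).submatrix id
              fun j => finProdFinEquiv.symm (Fin.castLE h j)) := hf.comp hmap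
        rw [lintegral_map hfmap (measurable_mul_const w)]
        refine lintegral_congr fun u => congrArg f ?_
        ext i j
        simp [mul_apply]
    _ = _ := by simp

/-- Stacking `k` square matrices on top of each other. -/
def stack (d k : ℕ) :
    (Fin k → Matrix (Fin d) (Fin d) ℂ) ≃ₗ[ℝ] Matrix (Fin k × Fin d) (Fin d) ℂ where
  toFun G := Matrix.of fun p j => G p.1 p.2 j
  map_add' _ _ := rfl
  map_smul' _ _ := rfl
  invFun X i := X.submatrix (Prod.mk i) id
  left_inv _ := rfl
  right_inv _ := rfl

theorem stack_apply (G : Fin k → Matrix (Fin d) (Fin d) ℂ) (p : Fin k × Fin d) (j : Fin d) :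
    stack d k G p j = G p.1 p.2 j := rfl

theorem stack_symm_mul {s : Type*} [Fintype s] (X : Matrix (Fin k × Fin d) s ℂ)
    (R : Matrix s (Fin d) ℂ) (i : Fin k) :
    (stack d k).symm (X * R) i = X.submatrix (Prod.mk i) id * R := rfl

theorem conjTranspose_stack_mul_stack (G : Fin k → Matrix (Fin d) (Fin d) ℂ) :
    (stack d k G)ᴴ * stack d k G = ∑ i, (G i)ᴴ * G i := by
  ext a b
  simp [mul_apply, stack_apply, Fintype.sum_prod_type, Matrix.sum_apply]

/-- Left multiplication of a stack of square matrices by a matrix. -/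
def mulStack (U : Matrix (Fin k × Fin d) (Fin k × Fin d) ℂ) :
    (Fin k → Matrix (Fin d) (Fin d) ℂ) →ₗ[ℝ] (Fin k → Matrix (Fin d) (Fin d) ℂ) where
  toFun G := (stack d k).symm (U * stack d k G)
  map_add' _ _ := by simp [Matrix.mul_add]
  map_smul' _ _ := by simp

theorem stack_mulStack (U : Matrix (Fin k × Fin d) (Fin k × Fin d) ℂ)
    (G : Fin k → Matrix (Fin d) (Fin d) ℂ) : stack d k (mulStack U G) = U * stack d k G :=
  (stack d k).apply_symm_apply _

theorem sum_mulStack (u : Matrix.unitaryGroup (Fin k × Fin d) ℂ)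
    (G : Fin k → Matrix (Fin d) (Fin d) ℂ) :
    ∑ i, (mulStack u.1 G i)ᴴ * mulStack u.1 G i = ∑ i, (G i)ᴴ * G i := by
  have hu : (u.1)ᴴ * u.1 = 1 := Matrix.UnitaryGroup.star_mul_self u
  rw [← conjTranspose_stack_mul_stack, stack_mulStack, conjTranspose_mul, Matrix.mul_assoc,
    ← Matrix.mul_assoc (u.1)ᴴ, hu, Matrix.one_mul, conjTranspose_stack_mul_stack]

theorem det_mulStack_ne_zero (u : Matrix.unitaryGroup (Fin k × Fin d) ℂ) :
    LinearMap.det (mulStack (d := d) u.1) ≠ 0 := by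
  have hu : u.1 * (u.1)ᴴ = 1 := u.2.2
  have h : mulStack (d := d) u.1 ∘ₗ mulStack (u.1)ᴴ = LinearMap.id := by
    refine LinearMap.ext fun G => (stack d k).injective ?_
    rw [LinearMap.comp_apply, stack_mulStack, stack_mulStack, ← Matrix.mul_assoc, hu,
      Matrix.one_mul, LinearMap.id_apply]
  have := congrArg LinearMap.det h
  rw [LinearMap.det_comp, LinearMap.det_id] at this
  exact left_ne_zero_of_mul (this ▸ one_ne_zero)

/-- The law of `k` independent square Ginibre matrices. -/
abbrev ginibreTuple (d k : ℕ) : Measure (Fin k → Matrix (Fin d) (Fin d) ℂ) :=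
  Measure.pi fun _ => ginibre d d

theorem ginibreTuple_eq_withDensity (d k : ℕ) : ∃ c : ℝ≥0∞, c ≠ ∞ ∧
    ginibreTuple d k = (Measure.pi fun _ : Fin k => lebesgueMatrix d d).withDensity
      fun G => c * expNegTrace (∑ i, (G i)ᴴ * G i) := by
  obtain ⟨c, hc, h⟩ := ginibre_eq_withDensity d d
  have hg : Measurable fun G : Matrix (Fin d) (Fin d) ℂ => c * expNegTrace (Gᴴ * G) :=
    (measurable_expNegTrace.comp measurable_conjTranspose_mul_self).const_mul c
  refine ⟨c ^ k, by finiteness, ?_⟩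
  rw [ginibreTuple, h,
    pi_withDensity _ hg fun G => ENNReal.mul_ne_top hc (expNegTrace_ne_top _)]
  congr 1
  funext G
  rw [Finset.prod_mul_distrib, prod_expNegTrace, Finset.prod_const, Finset.card_univ,
    Fintype.card_fin]

/-- A stack of Ginibre matrices is unitarily invariant: its density is, and the Jacobian is a
constant, equal to one because total masses agree. -/
theorem map_mulStack_ginibreTuple (u : Matrix.unitaryGroup (Fin k × Fin d) ℂ) :
    (ginibreTuple d k).map (mulStack u.1) = ginibreTuple d k := by
  obtain ⟨c, hc, h⟩ := ginibreTuple_eq_withDensity d k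
  have hρ : Measurable fun G : Fin k → Matrix (Fin d) (Fin d) ℂ =>
      c * expNegTrace (∑ i, (G i)ᴴ * G i) :=
    (measurable_expNegTrace.comp (Continuous.measurable (by fun_prop))).const_mul c
  have hmeas : Measurable (mulStack (d := d) u.1) :=
    (LinearMap.continuous_of_finiteDimensional _).measurable
  have key : ∀ f : (Fin k → Matrix (Fin d) (Fin d) ℂ) → ℝ≥0∞, Measurable f →
      ∫⁻ G, f (mulStack u.1 G) ∂(ginibreTuple d k) =
        ENNReal.ofReal |(LinearMap.det (mulStack (d := d) u.1))⁻¹| *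
          ∫⁻ G, f G ∂(ginibreTuple d k) := fun f hf => by
    have hfm : Measurable fun G => f (mulStack u.1 G) := hf.comp hmeas
    rw [h, lintegral_withDensity_eq_lintegral_mul _ hρ hfm,
      lintegral_withDensity_eq_lintegral_mul _ hρ hf,
      ← lintegral_comp_linearMap _ (det_mulStack_ne_zero u)]
    refine lintegral_congr fun G => ?_
    simp only [Pi.mul_apply, sum_mulStack]
  have hone := key 1 measurable_one
  simp only [Pi.one_apply, lintegral_one, measure_univ, mul_one] at hone
  refine Measure.ext_of_lintegral _ fun f hf => ?_
  rw [lintegral_map hf hmeas, key f hf, ← hone, one_mul]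

theorem ae_posDef_ginibreTuple (hk : 0 < k) :
    ∀ᵐ G ∂(ginibreTuple d k), (∑ i, (G i)ᴴ * G i).PosDef := by
  obtain ⟨c, hc, h⟩ := ginibreTuple_eq_withDensity d k
  rw [h]
  refine (withDensity_absolutelyContinuous _ _).ae_le ?_
  filter_upwards [ae_det_ne_zero (Measure.pi fun _ : Fin k => lebesgueMatrix d d)
    (LinearMap.proj ⟨0, hk⟩) (e := fun _ => 1) rfl] with G hG
  have h1 : ((G ⟨0, hk⟩)ᴴ * G ⟨0, hk⟩).PosDef := by
    refine (posSemidef_conjTranspose_mul_self _).posDef_iff_det_ne_zero.mpr ?_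
    rw [det_mul, det_conjTranspose]
    exact mul_ne_zero (star_ne_zero.mpr hG) hG
  rw [← Finset.add_sum_erase _ _ (Finset.mem_univ ⟨0, hk⟩)]
  exact h1.add_posSemidef (posSemidef_sum _ fun i _ => posSemidef_conjTranspose_mul_self _)

/-- The polar part `G (Gᴴ G)^(-1/2)` of a stack of square matrices. -/
def polarPart (G : Fin k → Matrix (Fin d) (Fin d) ℂ) : Matrix (Fin k × Fin d) (Fin d) ℂ :=
  stack d k G * invSqrt (∑ i, (G i)ᴴ * G i)

theorem measurable_polarPart : Measurable (polarPart (d := d) (k := k)) := by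
  have h1 : Measurable fun G : Fin k → Matrix (Fin d) (Fin d) ℂ =>
      (stack d k G, invSqrt (∑ i, (G i)ᴴ * G i)) :=
    ((stack d k).toLinearMap.continuous_of_finiteDimensional.measurable).prodMk
      (measurable_invSqrt.comp (Continuous.measurable (by fun_prop)))
  have h2 : Continuous fun p : Matrix (Fin k × Fin d) (Fin d) ℂ × Matrix (Fin d) (Fin d) ℂ =>
      p.1 * p.2 := by fun_prop
  have := h2.measurable.comp h1
  exact this

/-- The polar part of a stack of Ginibre matrices is a Haar-random isometry. -/
theorem map_polarPart_ginibreTuple (hk : 0 < k) :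
    (ginibreTuple d k).map polarPart = haarIsometry d k d (Nat.le_mul_of_pos_left d hk) := by
  have : IsProbabilityMeasure ((ginibreTuple d k).map polarPart) :=
    Measure.isProbabilityMeasure_map measurable_polarPart.aemeasurable
  refine eq_haarIsometry _ _ (fun u => ?_) ?_
  · have hmeas : Measurable (mulStack (d := d) u.1) :=
      (LinearMap.continuous_of_finiteDimensional _).measurable
    rw [Measure.map_map (Continuous.measurable (by fun_prop)) measurable_polarPart]
    conv_rhs => rw [← map_mulStack_ginibreTuple u, Measure.map_map measurable_polarPart hmeas]
    congr 1
    funext G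
    simp only [Function.comp_apply, polarPart]
    rw [sum_mulStack, stack_mulStack, Matrix.mul_assoc]
  · have hm : MeasurableSet {V : Matrix (Fin k × Fin d) (Fin d) ℂ | Vᴴ * V = 1} :=
      (isClosed_eq (by fun_prop) (by fun_prop)).measurableSet
    rw [ae_map_iff measurable_polarPart.aemeasurable hm]
    filter_upwards [ae_posDef_ginibreTuple hk] with G hG
    rw [polarPart, conjTranspose_mul, (invSqrt_isHermitian _).eq, Matrix.mul_assoc,
      ← Matrix.mul_assoc (stack d k G)ᴴ, conjTranspose_stack_mul_stack, ← mul_assoc,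
      hG.invSqrt_mul_self]

theorem measurable_blocks :
    Measurable fun (V : Matrix (Fin k × Fin d) (Fin d) ℂ) (i : Fin k) =>
      ((stack d k).symm V i)ᴴ * (stack d k).symm V i :=
  Continuous.measurable (continuous_pi fun i => by
    have h : Continuous fun V : Matrix (Fin k × Fin d) (Fin d) ℂ => (stack d k).symm V i :=
      continuous_id.matrix_submatrix _ _
    exact h.matrix_conjTranspose.matrix_mul h)

/-- In terms of Ginibre matrices, the normalized Wishart matrices are `Vᵢᴴ Vᵢ`, where `Vᵢ` are the
blocks of the polar part, a Haar-random isometry. -/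
theorem wishartPOVM_eq_map_haarIsometry (hk : 0 < k) :
    wishartPOVM d k (fun _ => d) = (haarIsometry d k d (Nat.le_mul_of_pos_left d hk)).map
      fun V i => ((stack d k).symm V i)ᴴ * (stack d k).symm V i := by
  have hw : Measurable fun (G : Fin k → Matrix (Fin d) (Fin d) ℂ) (i : Fin k) => (G i)ᴴ * G i :=
    measurable_pi_lambda _ fun i => measurable_conjTranspose_mul_self.comp (measurable_pi_apply i)
  have hpi : (Measure.pi fun _ : Fin k => wishart d d) = (ginibreTuple d k).map
      fun G i => (G i)ᴴ * G i := by
    have (i : Fin k) : SigmaFinite ((ginibre d d).map fun G => Gᴴ * G) :=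
      inferInstanceAs (SigmaFinite (wishart d d))
    exact (Measure.pi_map_pi fun _ => measurable_conjTranspose_mul_self.aemeasurable).symm
  rw [wishartPOVM, hpi, Measure.map_map measurable_normalizeTuple hw,
    ← map_polarPart_ginibreTuple hk, Measure.map_map measurable_blocks measurable_polarPart]
  congr 1
  funext G i
  have hblock : (stack d k).symm (polarPart G) i = G i * invSqrt (∑ j, (G j)ᴴ * G j) :=
    stack_symm_mul _ _ _
  simp only [Function.comp_apply, normalizeTuple, hblock, conjTranspose_mul,
    (invSqrt_isHermitian _).eq, mul_assoc]

/-- Up to a unitary matrix acting on the first tensor factor, any orthonormal basis is the standard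
one, for which the effects of the POVM are `Vᵢᴴ Vᵢ`, where `Vᵢ` are the blocks of `V`. -/
theorem stinespring_ketBra (e : OrthonormalBasis (Fin k) ℂ (EuclideanSpace ℂ (Fin k))) :
    ∃ u : Matrix.unitaryGroup (Fin k × Fin d) ℂ,
      ∀ (V : Matrix (Fin k × Fin d) (Fin d) ℂ) (i : Fin k),
        stinespring V (ketBra (e i)) =
          ((stack d k).symm (u.1 * V) i)ᴴ * (stack d k).symm (u.1 * V) i := by
  let E : Matrix (Fin k) (Fin k) ℂ := (EuclideanSpace.basisFun (Fin k) ℂ).toBasis.toMatrix e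
  have hE : ∀ p i, E p i = e i p := fun p i => by
    simp [E, Module.Basis.toMatrix_apply]
  have hEu : E ∈ Matrix.unitaryGroup (Fin k) ℂ :=
    (EuclideanSpace.basisFun (Fin k) ℂ).toMatrix_orthonormalBasis_mem_unitary e
  have hu : Eᴴ ⊗ₖ (1 : Matrix (Fin d) (Fin d) ℂ) ∈ Matrix.unitaryGroup (Fin k × Fin d) ℂ := by
    rw [mem_unitaryGroup_iff, star_eq_conjTranspose, conjTranspose_kronecker, ← mul_kronecker_mul,
      conjTranspose_one, one_mul, conjTranspose_conjTranspose]
    have : Eᴴ * E = 1 := mem_unitaryGroup_iff'.mp hEu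
    rw [this, one_kronecker_one]
  refine ⟨⟨_, hu⟩, fun V i => ?_⟩
  set C := (Eᴴ ⊗ₖ (1 : Matrix (Fin d) (Fin d) ℂ)).submatrix (Prod.mk i) id with hC
  have hX : ketBra (e i) ⊗ₖ (1 : Matrix (Fin d) (Fin d) ℂ) = Cᴴ * C := by
    ext ⟨p, m⟩ ⟨q, m'⟩
    simp [hC, mul_apply, kroneckerMap_apply, ketBra, hE, one_apply]
    by_cases h : m = m'
    · simp [h]
    · simp [h, Ne.symm h]
  rw [stinespring, hX, stack_symm_mul, conjTranspose_mul]
  simp only [Matrix.mul_assoc, hC]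

theorem map_mul_haarIsometry {n : ℕ} (h : d ≤ k * n) (u : Matrix.unitaryGroup (Fin k × Fin n) ℂ) :
    (haarIsometry d k n h).map (fun V => u.1 * V) = haarIsometry d k n h := by
  have hm := measurable_haarIsometry_map d k n h
  rw [haarIsometry, Measure.map_map (Continuous.measurable (by fun_prop)) hm]
  conv_rhs => rw [← map_mul_left_eq_self (haarUnitary (Fin k × Fin n)) u,
    Measure.map_map hm (measurable_const_mul u)]
  congr 1

theorem haarPOVM_eq_wishartPOVM (hk : 0 < k)
    (e : OrthonormalBasis (Fin k) ℂ (EuclideanSpace ℂ (Fin k))) :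
    haarPOVM d k d (Nat.le_mul_of_pos_left d hk) e = wishartPOVM d k fun _ => d := by
  obtain ⟨u, hu⟩ := stinespring_ketBra (d := d) e
  rw [haarPOVM, wishartPOVM_eq_map_haarIsometry hk]
  conv_rhs => rw [← map_mul_haarIsometry _ u]
  rw [Measure.map_map measurable_blocks (Continuous.measurable (by fun_prop))]
  congr 1
  funext V i
  exact hu V i

end

end RandomPOVM

end

theorem mainTheorem3 (d k : ℕ) (hk : 0 < k)
    (vol : MeasureTheory.Measure (RandomPOVM.zeroSumHermitian d k)) [vol.IsAddHaarMeasure] :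
    0 < RandomPOVM.affineLebesgue vol (RandomPOVM.povmSet d k) ∧
    RandomPOVM.affineLebesgue vol (RandomPOVM.povmSet d k) < ∞ ∧
    (∃ C : ℝ≥0∞, 0 < C ∧ C < ∞ ∧
      RandomPOVM.wishartPOVM d k (fun _ => d) =
        (RandomPOVM.affineLebesgue vol).withDensity
          ((RandomPOVM.povmSet d k).indicator fun _ => C)) ∧
    RandomPOVM.wishartPOVM d k (fun _ => d) = RandomPOVM.uniformPOVM vol ∧
    ∀ e : OrthonormalBasis (Fin k) ℂ (EuclideanSpace ℂ (Fin k)),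
      RandomPOVM.haarPOVM d k d (Nat.le_mul_of_pos_left d hk) e =
        RandomPOVM.uniformPOVM vol := by
  open RandomPOVM in
  obtain ⟨K, hK⟩ := exists_wishartPOVM_apply vol hk
  have hm : MeasurableSet (povmSet d k) := isClosed_povmSet.measurableSet
  have hfin : affineLebesgue vol (povmSet d k) ≠ ∞ := affineLebesgue_povmSet_ne_top vol
  -- the constant `K` is determined by the total mass
  have hone : K * affineLebesgue vol (povmSet d k) = 1 := by
    have : IsProbabilityMeasure (wishartPOVM d k fun _ => d) :=
      Measure.isProbabilityMeasure_map measurable_normalizeTuple.aemeasurable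
    rw [← measure_univ (μ := wishartPOVM d k fun _ => d), hK _ .univ, Set.univ_inter]
  have hK0 : K ≠ 0 := left_ne_zero_of_mul (hone ▸ one_ne_zero)
  have hpos : affineLebesgue vol (povmSet d k) ≠ 0 := right_ne_zero_of_mul (hone ▸ one_ne_zero)
  have hKinv : K = (affineLebesgue vol (povmSet d k))⁻¹ := ENNReal.eq_inv_of_mul_eq_one_left hone
  have hunif : wishartPOVM d k (fun _ => d) = uniformPOVM vol := by
    refine Measure.ext fun B hB => ?_
    rw [hK B hB, uniformPOVM, ProbabilityTheory.cond_apply hm, hKinv, Set.inter_comm]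
  refine ⟨pos_iff_ne_zero.mpr hpos, hfin.lt_top, ⟨K, pos_iff_ne_zero.mpr hK0, ?_, ?_⟩, hunif,
    fun e => (haarPOVM_eq_wishartPOVM hk e).trans hunif⟩
  · rw [hKinv]
    exact (ENNReal.inv_ne_top.mpr hpos).lt_top
  · refine Measure.ext fun B hB => ?_
    rw [hK B hB, withDensity_apply _ hB, ← lintegral_indicator hB, Set.indicator_indicator,
      lintegral_indicator_const (hB.inter hm)]
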